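/- Let $a,b,c\in\mathbb{R}$ with $a+b>0$ and $c>0$. By a solution on $[0,\infty)$ of the problem $$x^2u''(x)=a\,x\,u'(x)+b\,u(x)-c\,(u'(x)-1)^2\quad (x>0),\qquad u(0)=0,$$ we mean a function $u\in C^0([0,\infty))\cap C^2((0,\infty))$ that satisfies the equation for every $x>0$ and the condition $u(0)=0$. Then there is one, and only one, solution $u$ of this problem on $[0,\infty)$ such that $0\le u(x)\le x$ for all $x>0$. Moreover, this solution is three times differentiable on $(0,\infty)$ and satisfies $u>0$, $u'>0$, $u''<0$ and $u'''>0$ on $(0,\infty)$. -/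

import Mathlib

/-- `IsGlobalSolution a b c u`: the restriction of `u` to `[0, ∞)` belongs to
`C⁰([0, ∞)) ∩ C²((0, ∞))`, solves `x² u'' = a x u' + b u - c (u' - 1)²` for all `x > 0`, and
satisfies `u(0) = 0`. The values of `u` on the negative half-line play no role. -/
structure IsGlobalSolution (a b c : ℝ) (u : ℝ → ℝ) : Prop where
  continuousOn : ContinuousOn u (Set.Ici 0)
  contDiffOn : ContDiffOn ℝ 2 u (Set.Ioi 0)
  ode : ∀ x : ℝ, 0 < x →
    x ^ 2 * deriv (deriv u) x = a * x * deriv u x + b * u x - c * (deriv u x - 1) ^ 2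
  initial : u 0 = 0

open Set Filter Topology
open scoped NNReal

/-! Put t = log x, p = u/x, q = u' and r = x u''. The equation becomes p' = q - p, q' = r, and 0 ≤ u
≤ x says that p stays in [0, 1] for all t: the theorem concerns orbits of a planar system confined
to a strip, with no a priori bound on q.

Signs: r' = (a+b) q + (⋯) r, so at a zero of r the derivative r' has the sign of q. If q > 0 and r ≥
0 at one time, both persist and q + b p becomes unbounded; if q < 0 and r ≤ 0, p becomes negative.
So q and r have opposite signs, q cannot vanish, and boundedness of p near -∞ leaves q > 0 > r
(`snd_pos`, `rate_neg`).

Uniqueness: monotonicity of q gives p → 1 at -∞ and p → 0 at +∞. The difference of two confined p's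
vanishes at both ends, and at a positive maximum its second derivative would be positive
(`fst_le_fst`).

Third derivative: y = x² u''' satisfies y' = r n + (⋯) y with n' = -2c e^{-t} y. As r < 0, this
excludes a bounded interval of negativity of y, and the behaviour at either end excludes an
unbounded one (`third_nonneg`).

Existence: shoot from (σ, σ) at time s. For σ = 0 the slope q is the first to change sign, for σ = 1
it is r; both behaviours are open, so some σ in between shows neither and its trajectory stays in
[0, 1]² (`exists_trajectory_right`). Letting s → -∞, compactness of the square yields a full orbit
(`exists_isConfinedOrbit`). -/

/-! ### Monotonicity, sign persistence and linear uniqueness -/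

/-- Mean value theorem for a function with a derivative at every point of `[s, t]`. -/
lemma exists_sub_eq_deriv_mul {f f' : ℝ → ℝ} {s t : ℝ} (hst : s < t)
    (hf : ∀ τ ∈ Icc s t, HasDerivAt f (f' τ) τ) :
    ∃ ξ ∈ Ioo s t, f t - f s = f' ξ * (t - s) := by
  obtain ⟨ξ, hξ, h⟩ := exists_hasDerivAt_eq_slope f f' hst
    (fun τ hτ => (hf τ hτ).continuousAt.continuousWithinAt)
    (fun τ hτ => hf τ (Ioo_subset_Icc_self hτ))
  refine ⟨ξ, hξ, ?_⟩
  rw [h, div_mul_cancel₀]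
  linarith

lemma mul_sub_le_sub_of_le_deriv {f f' : ℝ → ℝ} {s t k : ℝ} (hst : s ≤ t)
    (hf : ∀ τ ∈ Icc s t, HasDerivAt f (f' τ) τ) (hk : ∀ τ ∈ Icc s t, k ≤ f' τ) :
    k * (t - s) ≤ f t - f s := by
  rcases hst.eq_or_lt with rfl | h
  · simp
  · obtain ⟨ξ, hξ, e⟩ := exists_sub_eq_deriv_mul h hf
    rw [e]
    exact mul_le_mul_of_nonneg_right (hk ξ (Ioo_subset_Icc_self hξ)) (by linarith)

lemma sub_le_mul_sub_of_deriv_le {f f' : ℝ → ℝ} {s t k : ℝ} (hst : s ≤ t)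
    (hf : ∀ τ ∈ Icc s t, HasDerivAt f (f' τ) τ) (hk : ∀ τ ∈ Icc s t, f' τ ≤ k) :
    f t - f s ≤ k * (t - s) := by
  have := mul_sub_le_sub_of_le_deriv (f := fun x => - f x) (f' := fun x => - f' x) (k := -k) hst
    (fun τ hτ => (hf τ hτ).neg) (fun τ hτ => neg_le_neg (hk τ hτ))
  linarith

lemma lt_of_deriv_pos_of_Ioo {f f' : ℝ → ℝ} {s t : ℝ} (hst : s < t)
    (hf : ∀ τ ∈ Icc s t, HasDerivAt f (f' τ) τ) (hk : ∀ τ ∈ Ioo s t, 0 < f' τ) : f s < f t := by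
  obtain ⟨ξ, hξ, e⟩ := exists_sub_eq_deriv_mul hst hf
  have := mul_pos (hk ξ hξ) (sub_pos.2 hst)
  linarith

lemma lt_of_deriv_neg_of_Ioo {f f' : ℝ → ℝ} {s t : ℝ} (hst : s < t)
    (hf : ∀ τ ∈ Icc s t, HasDerivAt f (f' τ) τ) (hk : ∀ τ ∈ Ioo s t, f' τ < 0) : f t < f s := by
  obtain ⟨ξ, hξ, e⟩ := exists_sub_eq_deriv_mul hst hf
  have := mul_neg_of_neg_of_pos (hk ξ hξ) (sub_pos.2 hst)
  linarith

lemma HasDerivAt.exists_forall_Ioo_lt {f : ℝ → ℝ} {d t : ℝ} (hf : HasDerivAt f d t) (hd : 0 < d) :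
    ∃ δ > 0, (∀ τ ∈ Ioo t (t + δ), f t < f τ) ∧ ∀ τ ∈ Ioo (t - δ) t, f τ < f t := by
  have h := (hasDerivAt_iff_tendsto_slope.1 hf).eventually (lt_mem_nhds hd)
  rw [eventually_nhdsWithin_iff, Metric.eventually_nhds_iff] at h
  obtain ⟨δ, hδ, h⟩ := h
  refine ⟨δ, hδ, fun τ hτ => ?_, fun τ hτ => ?_⟩
  · have := h (y := τ) (by rw [Real.dist_eq, abs_lt]; constructor <;> linarith [hτ.1, hτ.2])
      (by simpa using hτ.1.ne')
    rw [slope_def_field, div_pos_iff] at this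
    rcases this with h | h <;> linarith [h.1, h.2, hτ.1]
  · have := h (y := τ) (by rw [Real.dist_eq, abs_lt]; constructor <;> linarith [hτ.1, hτ.2])
      (by simpa using hτ.2.ne)
    rw [slope_def_field, div_pos_iff] at this
    rcases this with h | h <;> linarith [h.1, h.2, hτ.2]

lemma HasDerivAt.exists_forall_Ioo_gt {f : ℝ → ℝ} {d t : ℝ} (hf : HasDerivAt f d t) (hd : d < 0) :
    ∃ δ > 0, (∀ τ ∈ Ioo t (t + δ), f τ < f t) ∧ ∀ τ ∈ Ioo (t - δ) t, f t < f τ := by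
  obtain ⟨δ, h0, h1, h2⟩ := hf.neg.exists_forall_Ioo_lt (by linarith)
  exact ⟨δ, h0, fun τ hτ => by simpa using h1 τ hτ, fun τ hτ => by simpa using h2 τ hτ⟩

/-- A function which is nonnegative at `s` and can only vanish with positive derivative stays
nonnegative. -/
lemma nonneg_of_deriv_pos_of_eq_zero {f f' : ℝ → ℝ} {s : ℝ}
    (hf : ∀ t, s ≤ t → HasDerivAt f (f' t) t) (hs : 0 ≤ f s)
    (h0 : ∀ t, s ≤ t → (∀ τ ∈ Icc s t, 0 ≤ f τ) → f t = 0 → 0 < f' t) :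
    ∀ t, s ≤ t → 0 ≤ f t := by
  by_contra! hcon
  obtain ⟨t₁, hst₁, ht₁⟩ := hcon
  let N : Set ℝ := {t | s ≤ t ∧ t ≤ t₁ ∧ f t < 0}
  have hN : t₁ ∈ N := ⟨hst₁, le_rfl, ht₁⟩
  have hbd : BddBelow N := ⟨s, fun t ht => ht.1⟩
  set T := sInf N with hT
  have hsT : s ≤ T := le_csInf ⟨_, hN⟩ fun t ht => ht.1
  have hTt : T ≤ t₁ := csInf_le hbd hN
  have hbefore : ∀ τ, s ≤ τ → τ < T → 0 ≤ f τ := by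
    intro τ h1 h2
    by_contra! h
    exact absurd (csInf_le hbd (show τ ∈ N from ⟨h1, by linarith, h⟩)) (not_le.2 h2)
  have hcont := (hf T hsT).continuousAt
  have hTnonneg : 0 ≤ f T := by
    rcases hsT.eq_or_lt with h | h
    · rw [← h]; exact hs
    · by_contra! hneg
      obtain ⟨δ, hδ, hb⟩ := Metric.eventually_nhds_iff.1 (hcont.eventually (gt_mem_nhds hneg))
      have hm : max s (T - δ / 2) < T := max_lt h (by linarith)
      have h1 := hb (y := max s (T - δ / 2)) (by
        rw [Real.dist_eq, abs_lt]
        constructor <;> linarith [le_max_right s (T - δ / 2)])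
      have h2 := hbefore _ (le_max_left _ _) hm
      linarith
  -- Negative values accumulate at T from the right, which contradicts both f T > 0 and f T = 0 with
  -- positive derivative.
  have hnear : ∀ δ > 0, ∃ t ∈ N, T ≤ t ∧ t < T + δ := by
    intro δ hδ
    obtain ⟨t, ht, hlt⟩ := exists_lt_of_csInf_lt ⟨_, hN⟩ (show sInf N < T + δ by linarith)
    exact ⟨t, ht, csInf_le hbd ht, hlt⟩
  rcases hTnonneg.eq_or_lt with h | h
  · have hd := h0 T hsT (fun τ hτ => by
      rcases hτ.2.eq_or_lt with e | e
      · rw [e]; exact hTnonneg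
      · exact hbefore τ hτ.1 e) h.symm
    obtain ⟨δ, hδ, hr, -⟩ := (hf T hsT).exists_forall_Ioo_lt hd
    obtain ⟨t, ht, h1, h2⟩ := hnear δ hδ
    rcases h1.eq_or_lt with e | e
    · have := ht.2.2
      rw [← e] at this
      linarith
    · have := hr t ⟨e, h2⟩
      linarith [ht.2.2]
  · obtain ⟨δ, hδ, hb⟩ := Metric.eventually_nhds_iff.1 (hcont.eventually (lt_mem_nhds h))
    obtain ⟨t, ht, h1, h2⟩ := hnear δ hδ
    have := hb (y := t) (by rw [Real.dist_eq, abs_lt]; constructor <;> linarith)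
    linarith [ht.2.2]

/-- A planar homogeneous linear system with continuous coefficients has only the trivial solution
vanishing at a given point. -/
lemma planar_linear_eq_zero {z w α β γ δ : ℝ → ℝ} {l m t₀ : ℝ} (ht₀ : t₀ ∈ Icc l m)
    (hα : ContinuousOn α (Icc l m)) (hβ : ContinuousOn β (Icc l m))
    (hγ : ContinuousOn γ (Icc l m)) (hδ : ContinuousOn δ (Icc l m))
    (hz : ∀ t ∈ Icc l m, HasDerivAt z (α t * z t + β t * w t) t)
    (hw : ∀ t ∈ Icc l m, HasDerivAt w (γ t * z t + δ t * w t) t)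
    (hz0 : z t₀ = 0) (hw0 : w t₀ = 0) : ∀ t ∈ Icc l m, z t = 0 ∧ w t = 0 := by
  obtain ⟨A, hA⟩ := isCompact_Icc.exists_bound_of_continuousOn hα
  obtain ⟨B, hB⟩ := isCompact_Icc.exists_bound_of_continuousOn hβ
  obtain ⟨C, hC⟩ := isCompact_Icc.exists_bound_of_continuousOn hγ
  obtain ⟨D, hD⟩ := isCompact_Icc.exists_bound_of_continuousOn hδ
  simp only [Real.norm_eq_abs, abs_le] at hA hB hC hD
  set K : ℝ := 2 * (A + B + C + D) with hK
  let E : ℝ → ℝ := fun t => z t ^ 2 + w t ^ 2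
  let E' : ℝ → ℝ := fun t =>
    2 * z t * (α t * z t + β t * w t) + 2 * w t * (γ t * z t + δ t * w t)
  have hE : ∀ t ∈ Icc l m, HasDerivAt E (E' t) t := fun t ht => by
    refine (((hz t ht).pow 2).add ((hw t ht).pow 2)).congr_deriv ?_
    simp only [E']; ring
  have hbound : ∀ t ∈ Icc l m, -K * E t ≤ E' t ∧ E' t ≤ K * E t := by
    intro t ht
    obtain ⟨a1, a2⟩ := hA t ht
    obtain ⟨b1, b2⟩ := hB t ht
    obtain ⟨c1, c2⟩ := hC t ht
    obtain ⟨d1, d2⟩ := hD t ht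
    -- Expanding the squares of z ± w, these bound ±2βzw by B(z² + w²), and likewise for γ; hence
    -- |E'| ≤ K E, a Grönwall inequality used in both time directions.
    have p1 := mul_nonneg (sub_nonneg.2 a2) (sq_nonneg (z t))
    have p2 := mul_nonneg (sub_nonneg.2 d2) (sq_nonneg (w t))
    have p3 := mul_nonneg (neg_le_iff_add_nonneg.1 a1) (sq_nonneg (z t))
    have p4 := mul_nonneg (neg_le_iff_add_nonneg.1 d1) (sq_nonneg (w t))
    have q1 := mul_nonneg (sub_nonneg.2 b2) (sq_nonneg (z t + w t))
    have q2 := mul_nonneg (sub_nonneg.2 c2) (sq_nonneg (z t + w t))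
    have q3 := mul_nonneg (neg_le_iff_add_nonneg.1 b1) (sq_nonneg (z t - w t))
    have q4 := mul_nonneg (neg_le_iff_add_nonneg.1 c1) (sq_nonneg (z t - w t))
    have q5 := mul_nonneg (sub_nonneg.2 b2) (sq_nonneg (z t - w t))
    have q6 := mul_nonneg (sub_nonneg.2 c2) (sq_nonneg (z t - w t))
    have q7 := mul_nonneg (neg_le_iff_add_nonneg.1 b1) (sq_nonneg (z t + w t))
    have q8 := mul_nonneg (neg_le_iff_add_nonneg.1 c1) (sq_nonneg (z t + w t))
    have r1 := mul_nonneg (show 0 ≤ A by linarith) (sq_nonneg (w t))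
    have r2 := mul_nonneg (show 0 ≤ D by linarith) (sq_nonneg (z t))
    have r3 := mul_nonneg (show 0 ≤ B by linarith) (add_nonneg (sq_nonneg (w t)) (sq_nonneg (z t)))
    have r4 := mul_nonneg (show 0 ≤ C by linarith) (add_nonneg (sq_nonneg (w t)) (sq_nonneg (z t)))
    simp only [hK, E, E']
    constructor <;> linarith
  have hexp : ∀ k t : ℝ, HasDerivAt (fun t => Real.exp (k * t)) (k * Real.exp (k * t)) t := by
    intro k t
    simpa [mul_comm] using ((hasDerivAt_id t).const_mul k).exp
  have hE0 : E t₀ = 0 := by simp [E, hz0, hw0]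
  have key : ∀ t ∈ Icc l m, E t ≤ 0 := by
    intro t ht
    rcases le_total t t₀ with h | h
    · have hsub : ∀ τ ∈ Icc t t₀, τ ∈ Icc l m := fun τ hτ =>
        ⟨ht.1.trans hτ.1, hτ.2.trans ht₀.2⟩
      have := mul_sub_le_sub_of_le_deriv (k := 0) h
        (fun τ hτ => (hE τ (hsub τ hτ)).mul (hexp K τ)) (fun τ hτ => by
          have := mul_nonneg (sub_nonneg.2 (hbound τ (hsub τ hτ)).1) (Real.exp_pos (K * τ)).le
          linarith)
      simp only [Pi.mul_apply, hE0] at this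
      have hp := Real.exp_pos (K * t)
      by_contra! hc
      nlinarith [mul_pos hc hp]
    · have hsub : ∀ τ ∈ Icc t₀ t, τ ∈ Icc l m := fun τ hτ =>
        ⟨ht₀.1.trans hτ.1, hτ.2.trans ht.2⟩
      have := sub_le_mul_sub_of_deriv_le (k := 0) h
        (fun τ hτ => (hE τ (hsub τ hτ)).mul (hexp (-K) τ)) (fun τ hτ => by
          have := mul_nonneg (sub_nonneg.2 (hbound τ (hsub τ hτ)).2) (Real.exp_pos (-K * τ)).le
          linarith)
      simp only [Pi.mul_apply, hE0] at this
      have hp := Real.exp_pos (-K * t)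
      by_contra! hc
      nlinarith [mul_pos hc hp]
  intro t ht
  have h := key t ht
  simp only [E] at h
  constructor <;> nlinarith [sq_nonneg (z t), sq_nonneg (w t)]

/-! ### The planar system and its derived quantities -/

/-- In the variables `t = log x`, `p = u / x`, `q = u'`, the equation reads `p' = q - p`,
`q' = slopeRate a b c p q`. -/
noncomputable def slopeRate (a b c : ℝ) (p q : ℝ → ℝ) (t : ℝ) : ℝ :=
  a * q t + b * p t - c * Real.exp (-t) * (q t - 1) ^ 2

/-- The coefficient of r in the linear equation for r = `slopeRate`. -/
noncomputable def slopeDamping (a c : ℝ) (q : ℝ → ℝ) (t : ℝ) : ℝ :=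
  a - 1 + 2 * c * Real.exp (-t) * (1 - q t)

/-- `x² u'''` in the variables `t = log x`, `p = u / x`, `q = u'`. -/
noncomputable def thirdRate (a b c : ℝ) (p q : ℝ → ℝ) (t : ℝ) : ℝ :=
  (a + b) * q t + (slopeDamping a c q t - 1) * slopeRate a b c p q t

/-- The coefficient of r in the equation for `thirdRate`. With r regarded as a known coefficient,
this quantity and `thirdRate` solve a linear homogeneous planar system. -/
noncomputable def thirdForcing (a b c : ℝ) (p q : ℝ → ℝ) (t : ℝ) : ℝ :=
  2 * a + b - 2 - 2 * c * Real.exp (-t) * slopeRate a b c p q t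

lemma hasDerivAt_exp_neg (t : ℝ) : HasDerivAt (fun t => Real.exp (-t)) (-Real.exp (-t)) t := by
  simpa using (hasDerivAt_id t).neg.exp

section Derivatives

variable {a b c : ℝ} {p q : ℝ → ℝ} {t : ℝ}

/-- The terms in p and the undifferentiated square recombine into r itself, so p disappears and the
source term is (a + b) q. -/
lemma hasDerivAt_slopeRate (hp : HasDerivAt p (q t - p t) t)
    (hq : HasDerivAt q (slopeRate a b c p q t) t) :
    HasDerivAt (slopeRate a b c p q)
      ((a + b) * q t + slopeDamping a c q t * slopeRate a b c p q t) t := by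
  have := ((hq.const_mul a).add (hp.const_mul b)).sub
    (((hasDerivAt_exp_neg t).const_mul c).mul ((hq.sub_const 1).pow 2))
  refine this.congr_deriv ?_
  simp only [slopeDamping, slopeRate, Pi.pow_apply]
  ring

lemma hasDerivAt_slopeDamping (hq : HasDerivAt q (slopeRate a b c p q t) t) :
    HasDerivAt (slopeDamping a c q)
      (-2 * c * Real.exp (-t) * (1 - q t) - 2 * c * Real.exp (-t) * slopeRate a b c p q t) t := by
  have := (((hasDerivAt_exp_neg t).const_mul (2 * c)).mul (hq.const_sub 1)).const_add (a - 1)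
  refine this.congr_deriv ?_
  ring

lemma hasDerivAt_thirdRate (hp : HasDerivAt p (q t - p t) t)
    (hq : HasDerivAt q (slopeRate a b c p q t) t) :
    HasDerivAt (thirdRate a b c p q)
      (slopeRate a b c p q t * thirdForcing a b c p q t
        + (slopeDamping a c q t - 1) * thirdRate a b c p q t) t := by
  have := (hq.const_mul (a + b)).add
    (((hasDerivAt_slopeDamping hq).sub_const 1).mul (hasDerivAt_slopeRate hp hq))
  refine this.congr_deriv ?_
  simp only [thirdForcing, thirdRate, slopeDamping]
  ring

lemma hasDerivAt_thirdForcing (hp : HasDerivAt p (q t - p t) t)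
    (hq : HasDerivAt q (slopeRate a b c p q t) t) :
    HasDerivAt (thirdForcing a b c p q)
      (-2 * c * Real.exp (-t) * thirdRate a b c p q t) t := by
  have := (((hasDerivAt_exp_neg t).const_mul (2 * c)).mul
    (hasDerivAt_slopeRate hp hq)).const_sub (2 * a + b - 2)
  refine this.congr_deriv ?_
  simp only [thirdRate]
  ring

end Derivatives

/-! ### Signs of u' and u'' along confined orbits -/

/-- Orbits of the planar system, defined for all times, with `p` confined to `[0, 1]`. -/
structure IsConfinedOrbit (a b c : ℝ) (p q : ℝ → ℝ) : Prop where
  hasDerivAt_fst : ∀ t, HasDerivAt p (q t - p t) t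
  hasDerivAt_snd : ∀ t, HasDerivAt q (slopeRate a b c p q t) t
  fst_nonneg : ∀ t, 0 ≤ p t
  fst_le_one : ∀ t, p t ≤ 1

namespace IsConfinedOrbit

variable {a b c : ℝ} {p q : ℝ → ℝ}

lemma hasDerivAt_rate (h : IsConfinedOrbit a b c p q) (t : ℝ) :
    HasDerivAt (slopeRate a b c p q)
      ((a + b) * q t + slopeDamping a c q t * slopeRate a b c p q t) t :=
  hasDerivAt_slopeRate (h.hasDerivAt_fst t) (h.hasDerivAt_snd t)

/-- The combination q + b p is chosen so that p drops out of its derivative. -/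
lemma hasDerivAt_add_mul (h : IsConfinedOrbit a b c p q) (t : ℝ) :
    HasDerivAt (fun t => q t + b * p t)
      ((a + b) * q t - c * Real.exp (-t) * (q t - 1) ^ 2) t := by
  refine ((h.hasDerivAt_snd t).add ((h.hasDerivAt_fst t).const_mul b)).congr_deriv ?_
  simp only [slopeRate]
  ring

/-- This is the derivative of u - k x with respect to log x; it turns bounds on q into bounds on p.
-/
lemma hasDerivAt_exp_mul_sub (h : IsConfinedOrbit a b c p q) (k t : ℝ) :
    HasDerivAt (fun t => Real.exp t * (p t - k)) (Real.exp t * (q t - k)) t := by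
  refine ((Real.hasDerivAt_exp t).mul ((h.hasDerivAt_fst t).sub_const k)).congr_deriv ?_
  ring

lemma abs_mul_fst_le (h : IsConfinedOrbit a b c p q) (t : ℝ) : |b * p t| ≤ |b| := by
  rw [abs_mul, abs_of_nonneg (h.fst_nonneg t)]
  exact mul_le_of_le_one_right (abs_nonneg b) (h.fst_le_one t)

/-- The slope of a confined orbit cannot stay in `[κ, 1]` with `κ > 0`. -/
lemma not_forall_snd_mem_Icc (h : IsConfinedOrbit a b c p q) (hab : 0 < a + b) {s κ : ℝ}
    (hκ : 0 < κ) (hq : ∀ t, s ≤ t → κ ≤ q t ∧ q t ≤ 1) : False := by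
  have hlim : Tendsto (fun t : ℝ => c * Real.exp (-t)) atTop (𝓝 (c * 0)) :=
    (Real.tendsto_exp_neg_atTop_nhds_zero).const_mul c
  rw [mul_zero] at hlim
  -- Half of the lower bound (a+b)κ for the source; the other half absorbs the quadratic term once c
  -- e^{-t} < k.
  set k := (a + b) * κ / 2 with hk
  have hkpos : 0 < k := by positivity
  obtain ⟨T, hT⟩ := eventually_atTop.1 (hlim.eventually (gt_mem_nhds hkpos))
  set S := max s T with hS
  -- Long enough for q + b p to grow by 2 + 2|b| + k, while its oscillation is at most 1 + 2|b|.
  set L := (2 + 2 * |b|) / k + 1 with hL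
  have hLpos : 0 < L := by positivity
  have hge := mul_sub_le_sub_of_le_deriv (k := k) (show S ≤ S + L by linarith)
    (fun τ _ => h.hasDerivAt_add_mul τ) (fun τ hτ => by
      obtain ⟨h1, h2⟩ := hq τ ((le_max_left s T).trans hτ.1)
      have h3 := hT τ ((le_max_right s T).trans hτ.1)
      have h4 : (q τ - 1) ^ 2 ≤ 1 := by nlinarith
      have h5 : c * Real.exp (-τ) * (q τ - 1) ^ 2 ≤ k := by
        nlinarith [sq_nonneg (q τ - 1)]
      have h6 := mul_le_mul_of_nonneg_left h1 hab.le
      linarith)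
  have e : k * (S + L - S) = 2 + 2 * |b| + k := by
    rw [hL]; field_simp; ring
  rw [e] at hge
  have b1 := abs_le.1 (h.abs_mul_fst_le S)
  have b2 := abs_le.1 (h.abs_mul_fst_le (S + L))
  have q1 := hq S (le_max_left _ _)
  have q2 := hq (S + L) ((le_max_left s T).trans (by linarith))
  linarith [b1.1, b1.2, b2.1, b2.2, q1.1, q2.2]

/-- Otherwise p' ≥ q s - 1 > 0 from time s on, and p rises by 2 within time 2 / (q s - 1), leaving
[0, 1]. -/
lemma snd_le_of_monotone_right (h : IsConfinedOrbit a b c p q) {s : ℝ}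
    (hq : ∀ t, s ≤ t → q s ≤ q t) : q s ≤ 1 := by
  by_contra! hgt
  have hge := mul_sub_le_sub_of_le_deriv (k := q s - 1)
    (show s ≤ s + (2 / (q s - 1)) by
      have : 0 < 2 / (q s - 1) := div_pos two_pos (by linarith)
      linarith) (fun τ _ => h.hasDerivAt_fst τ) (fun τ hτ => by
        linarith [hq τ hτ.1, h.fst_le_one τ])
  have e : (q s - 1) * (s + 2 / (q s - 1) - s) = 2 := by
    have : q s - 1 ≠ 0 := by linarith
    field_simp
    ring
  rw [e] at hge
  linarith [h.fst_nonneg s, h.fst_le_one (s + 2 / (q s - 1))]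

/-- If r ≥ 0 at s, then r can only vanish with r' = (a+b) q > 0, so r stays nonnegative. Then q
increases, is capped at 1 by confinement, and stays in [q s, 1], which is impossible. -/
lemma rate_neg_of_snd_pos (h : IsConfinedOrbit a b c p q) (hab : 0 < a + b) {s : ℝ}
    (hs : 0 < q s) : slopeRate a b c p q s < 0 := by
  by_contra! hr
  have hmono : ∀ t, (∀ τ ∈ Icc s t, 0 ≤ slopeRate a b c p q τ) → s ≤ t → q s ≤ q t := by
    intro t ht hst
    have := mul_sub_le_sub_of_le_deriv (k := 0) hst (fun τ _ => h.hasDerivAt_snd τ) ht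
    linarith
  have hnn := nonneg_of_deriv_pos_of_eq_zero (fun t _ => h.hasDerivAt_rate t) hr
    (fun t hst hpos h0 => by
      have := hmono t hpos hst
      rw [h0, mul_zero, add_zero]
      exact mul_pos hab (by linarith))
  have hmono' : ∀ t t', s ≤ t → t ≤ t' → q t ≤ q t' := by
    intro t t' h1 h2
    have := mul_sub_le_sub_of_le_deriv (k := 0) h2 (fun τ _ => h.hasDerivAt_snd τ)
      (fun τ hτ => hnn τ (h1.trans hτ.1))
    linarith
  exact h.not_forall_snd_mem_Icc hab hs fun t hst => ⟨hmono' s t le_rfl hst,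
    h.snd_le_of_monotone_right fun t' ht' => hmono' t t' hst ht'⟩

/-- Mirror argument: if r ≤ 0 at s, q stays below q s < 0, and p' ≤ q s drives p below 0. -/
lemma rate_pos_of_snd_neg (h : IsConfinedOrbit a b c p q) (hab : 0 < a + b) {s : ℝ}
    (hs : q s < 0) : 0 < slopeRate a b c p q s := by
  by_contra! hr
  have hmono : ∀ t, (∀ τ ∈ Icc s t, slopeRate a b c p q τ ≤ 0) → s ≤ t → q t ≤ q s := by
    intro t ht hst
    have := sub_le_mul_sub_of_deriv_le (k := 0) hst (fun τ _ => h.hasDerivAt_snd τ) ht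
    linarith
  have hnn := nonneg_of_deriv_pos_of_eq_zero (f := fun t => - slopeRate a b c p q t) (s := s)
    (fun t _ => (h.hasDerivAt_rate t).neg) (by linarith)
    (fun t hst hpos h0 => by
      have := hmono t (fun τ hτ => by linarith [hpos τ hτ]) hst
      have h0' : slopeRate a b c p q t = 0 := by linarith
      rw [h0', mul_zero, add_zero]
      linarith [mul_pos_of_neg_of_neg (show -(a + b) < 0 by linarith)
        (show q t < 0 by linarith)])
  have hle : ∀ t, s ≤ t → q t ≤ q s := fun t hst =>
    hmono t (fun τ hτ => by linarith [hnn τ hτ.1]) hst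
  have hlt := sub_le_mul_sub_of_deriv_le (k := q s)
    (show s ≤ s + (2 / (- q s)) by
      have : 0 < 2 / (- q s) := div_pos two_pos (by linarith)
      linarith) (fun τ _ => h.hasDerivAt_fst τ) (fun τ hτ => by
        linarith [hle τ hτ.1, h.fst_nonneg τ])
  have e : q s * (s + 2 / (- q s) - s) = -2 := by
    have : q s ≠ 0 := hs.ne
    field_simp
    ring
  rw [e] at hlt
  linarith [h.fst_le_one s, h.fst_nonneg (s + 2 / (- q s))]

lemma continuous_fst (h : IsConfinedOrbit a b c p q) : Continuous p :=
  continuous_iff_continuousAt.2 fun t => (h.hasDerivAt_fst t).continuousAt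

lemma continuous_snd (h : IsConfinedOrbit a b c p q) : Continuous q :=
  continuous_iff_continuousAt.2 fun t => (h.hasDerivAt_snd t).continuousAt

lemma continuous_rate (h : IsConfinedOrbit a b c p q) : Continuous (slopeRate a b c p q) :=
  continuous_iff_continuousAt.2 fun t => (h.hasDerivAt_rate t).continuousAt

lemma continuous_damping (h : IsConfinedOrbit a b c p q) : Continuous (slopeDamping a c q) :=
  continuous_iff_continuousAt.2 fun t =>
    (hasDerivAt_slopeDamping (h.hasDerivAt_snd t)).continuousAt

/-- Linear uniqueness propagates q = r = 0 backwards, leaving b p = c e^{-t}, which is unbounded as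
t → -∞. -/
lemma not_snd_and_rate_eq_zero (h : IsConfinedOrbit a b c p q) (hc : 0 < c) {s : ℝ}
    (hq : q s = 0) (hr : slopeRate a b c p q s = 0) : False := by
  have hzero : ∀ t ≤ s, q t = 0 ∧ slopeRate a b c p q t = 0 := by
    intro t ht
    exact planar_linear_eq_zero (α := fun _ => 0) (β := fun _ => 1) (γ := fun _ => a + b)
      (δ := slopeDamping a c q) (l := t) (m := s) (right_mem_Icc.2 ht) continuousOn_const
      continuousOn_const continuousOn_const h.continuous_damping.continuousOn
      (fun τ _ => (h.hasDerivAt_snd τ).congr_deriv (by ring))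
      (fun τ _ => h.hasDerivAt_rate τ) hq hr t (left_mem_Icc.2 ht)
  have hlim : Tendsto (fun t : ℝ => c * Real.exp (-t)) atBot atTop :=
    (Real.tendsto_exp_atTop.comp tendsto_neg_atBot_atTop).const_mul_atTop hc
  obtain ⟨t, ht, hts⟩ := ((hlim.eventually_gt_atTop |b|).and (eventually_le_atBot s)).exists
  obtain ⟨h1, h2⟩ := hzero t hts
  simp only [slopeRate, h1] at h2
  have := (abs_le.1 (h.abs_mul_fst_le t)).2
  linarith

/-- At a zero of q with r ≠ 0, just afterwards q and r would share a sign. -/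
lemma snd_ne_zero (h : IsConfinedOrbit a b c p q) (hab : 0 < a + b) (hc : 0 < c) (s : ℝ) :
    q s ≠ 0 := by
  intro hq
  rcases lt_trichotomy (slopeRate a b c p q s) 0 with hr | hr | hr
  · obtain ⟨δ, hδ, hlt, -⟩ := (h.hasDerivAt_snd s).exists_forall_Ioo_gt hr
    obtain ⟨ε, hε, hneg⟩ := Metric.eventually_nhds_iff.1
      (h.continuous_rate.continuousAt.eventually (gt_mem_nhds hr))
    have hm : 0 < min δ ε := lt_min hδ hε
    have h1 := hlt (s + min δ ε / 2) ⟨by linarith, by linarith [min_le_left δ ε]⟩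
    have h2 := hneg (y := s + min δ ε / 2) (by
      rw [Real.dist_eq, abs_lt]; constructor <;> linarith [min_le_right δ ε])
    rw [hq] at h1
    exact lt_asymm h2 (h.rate_pos_of_snd_neg hab h1)
  · exact h.not_snd_and_rate_eq_zero hc hq hr
  · obtain ⟨δ, hδ, hlt, -⟩ := (h.hasDerivAt_snd s).exists_forall_Ioo_lt hr
    obtain ⟨ε, hε, hpos⟩ := Metric.eventually_nhds_iff.1
      (h.continuous_rate.continuousAt.eventually (lt_mem_nhds hr))
    have hm : 0 < min δ ε := lt_min hδ hε
    have h1 := hlt (s + min δ ε / 2) ⟨by linarith, by linarith [min_le_left δ ε]⟩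
    have h2 := hpos (y := s + min δ ε / 2) (by
      rw [Real.dist_eq, abs_lt]; constructor <;> linarith [min_le_right δ ε])
    rw [hq] at h1
    exact lt_asymm h2 (h.rate_neg_of_snd_pos hab h1)

/-- A negative q everywhere would make u = e^t p strictly decreasing, although u ≥ 0 and u → 0 as x
→ 0. -/
lemma snd_pos (h : IsConfinedOrbit a b c p q) (hab : 0 < a + b) (hc : 0 < c) (s : ℝ) :
    0 < q s := by
  by_contra! hs
  have hneg : ∀ t, q t < 0 := by
    intro t
    by_contra! ht
    obtain ⟨τ, -, hτ⟩ := isPreconnected_univ.intermediate_value (mem_univ s) (mem_univ t)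
      h.continuous_snd.continuousOn ⟨hs, ht⟩
    exact h.snd_ne_zero hab hc τ hτ
  have hd : ∀ t t', t < t' → Real.exp t' * (p t' - 0) < Real.exp t * (p t - 0) := fun t t' htt =>
    lt_of_deriv_neg_of_Ioo htt (fun τ _ => h.hasDerivAt_exp_mul_sub 0 τ) fun τ _ =>
      mul_neg_of_pos_of_neg (Real.exp_pos τ) (by linarith [hneg τ])
  have h1 := hd s (s + 1) (by linarith)
  have h2 : 0 ≤ Real.exp (s + 1) * (p (s + 1) - 0) :=
    mul_nonneg (Real.exp_pos _).le (by linarith [h.fst_nonneg (s + 1)])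
  have hpos : 0 < Real.exp s * (p s - 0) := by linarith
  obtain ⟨t, ht, hts⟩ := ((Real.tendsto_exp_atBot.eventually (gt_mem_nhds hpos)).and
    (eventually_lt_atBot s)).exists
  have h3 := hd t s hts
  have h4 : Real.exp t * (p t - 0) ≤ Real.exp t :=
    mul_le_of_le_one_right (Real.exp_pos _).le (by linarith [h.fst_le_one t])
  linarith

lemma rate_neg (h : IsConfinedOrbit a b c p q) (hab : 0 < a + b) (hc : 0 < c) (s : ℝ) :
    slopeRate a b c p q s < 0 :=
  h.rate_neg_of_snd_pos hab (h.snd_pos hab hc s)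

lemma snd_strictAnti (h : IsConfinedOrbit a b c p q) (hab : 0 < a + b) (hc : 0 < c) :
    StrictAnti q := fun _ _ hst =>
  lt_of_deriv_neg_of_Ioo hst (fun τ _ => h.hasDerivAt_snd τ) fun τ _ => h.rate_neg hab hc τ

lemma fst_pos (h : IsConfinedOrbit a b c p q) (hab : 0 < a + b) (hc : 0 < c) (s : ℝ) :
    0 < p s := by
  have := lt_of_deriv_pos_of_Ioo (show s - 1 < s by linarith)
    (fun τ _ => h.hasDerivAt_exp_mul_sub 0 τ) (fun τ _ =>
      mul_pos (Real.exp_pos τ) (by linarith [h.snd_pos hab hc τ]))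
  have h2 : 0 ≤ Real.exp (s - 1) * (p (s - 1) - 0) :=
    mul_nonneg (Real.exp_pos _).le (by linarith [h.fst_nonneg (s - 1)])
  have h3 := pos_of_mul_pos_right (h2.trans_lt this) (Real.exp_pos s).le
  linarith

/-! ### Limits of p and q at the two ends -/

lemma snd_le_one (h : IsConfinedOrbit a b c p q) (hab : 0 < a + b) (hc : 0 < c) (s : ℝ) :
    q s ≤ 1 := by
  by_contra! hgt
  have hpos : 0 < 2 / (q s - 1) := div_pos two_pos (by linarith)
  have hge := mul_sub_le_sub_of_le_deriv (k := q s - 1)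
    (show s - 2 / (q s - 1) ≤ s by linarith) (fun τ _ => h.hasDerivAt_fst τ) (fun τ hτ => by
        linarith [(h.snd_strictAnti hab hc).antitone hτ.2, h.fst_le_one τ])
  have e : (q s - 1) * (s - (s - 2 / (q s - 1))) = 2 := by
    have : q s - 1 ≠ 0 := by linarith
    field_simp
    ring
  rw [e] at hge
  linarith [h.fst_le_one s, h.fst_nonneg (s - 2 / (q s - 1))]

lemma exists_lt_snd (h : IsConfinedOrbit a b c p q) (hab : 0 < a + b) (hc : 0 < c) {Q : ℝ}
    (hQ : Q < 1) : ∃ s, Q < q s := by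
  by_contra! hle
  have hlim : Tendsto (fun t : ℝ => c * (1 - Q) ^ 2 * Real.exp (-t)) atBot atTop :=
    (Real.tendsto_exp_atTop.comp tendsto_neg_atBot_atTop).const_mul_atTop
      (mul_pos hc (pow_pos (sub_pos.2 hQ) 2))
  -- If q ≤ Q throughout, the quadratic term beats (a+b) q by at least 1 before T, so q + b p falls
  -- faster than its bounds allow.
  obtain ⟨T, hT⟩ := eventually_atBot.1 (hlim.eventually_ge_atTop (a + b + 1))
  have hpos : 0 < 2 + 2 * |b| := by positivity
  have hlt := sub_le_mul_sub_of_deriv_le (k := -1) (show T - (2 + 2 * |b|) ≤ T by linarith)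
    (fun τ _ => h.hasDerivAt_add_mul τ) (fun τ hτ => by
      have h1 := hT τ hτ.2
      have h2 := hle τ
      have h3 := h.snd_le_one hab hc τ
      have h4 : (1 - Q) ^ 2 ≤ (q τ - 1) ^ 2 := by nlinarith
      have h5 := mul_le_mul_of_nonneg_left h4 (mul_pos hc (Real.exp_pos (-τ))).le
      nlinarith)
  have b1 := abs_le.1 (h.abs_mul_fst_le T)
  have b2 := abs_le.1 (h.abs_mul_fst_le (T - (2 + 2 * |b|)))
  have q1 := h.snd_pos hab hc T
  have q2 := h.snd_le_one hab hc (T - (2 + 2 * |b|))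
  linarith [b1.1, b1.2, b2.1, b2.2]

lemma tendsto_snd_atBot (h : IsConfinedOrbit a b c p q) (hab : 0 < a + b) (hc : 0 < c) :
    Tendsto q atBot (𝓝 1) := by
  rw [tendsto_order]
  refine ⟨fun Q hQ => ?_, fun Q hQ => Eventually.of_forall fun t =>
    (h.snd_le_one hab hc t).trans_lt hQ⟩
  obtain ⟨s, hs⟩ := h.exists_lt_snd hab hc hQ
  filter_upwards [eventually_le_atBot s] with t ht
  exact hs.trans_le ((h.snd_strictAnti hab hc).antitone ht)

lemma tendsto_fst_atBot (h : IsConfinedOrbit a b c p q) (hab : 0 < a + b) (hc : 0 < c) :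
    Tendsto p atBot (𝓝 1) := by
  rw [tendsto_order]
  refine ⟨fun Q hQ => ?_, fun Q hQ => Eventually.of_forall fun t =>
    (h.fst_le_one t).trans_lt hQ⟩
  obtain ⟨R, hQR, hR⟩ := exists_between hQ
  obtain ⟨T, hT⟩ := h.exists_lt_snd hab hc hR
  filter_upwards [eventually_le_atBot T] with s hs
  refine hQR.trans_le ?_
  by_contra! hlt
  have hη : 0 < Real.exp s * (R - p s) := mul_pos (Real.exp_pos s) (by linarith)
  have hlim : Tendsto (fun t : ℝ => |R| * Real.exp t) atBot (𝓝 (|R| * 0)) :=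
    Real.tendsto_exp_atBot.const_mul _
  rw [mul_zero] at hlim
  obtain ⟨t, ht, hts⟩ := ((hlim.eventually (gt_mem_nhds hη)).and (eventually_le_atBot s)).exists
  -- u - R x is nondecreasing near 0 and tends to 0 there, so it cannot be negative.
  have h1 := mul_sub_le_sub_of_le_deriv (k := 0) hts (fun τ _ => h.hasDerivAt_exp_mul_sub R τ)
    (fun τ hτ => mul_nonneg (Real.exp_pos τ).le (by
      linarith [(h.snd_strictAnti hab hc).antitone (hτ.2.trans hs)]))
  have h2 := mul_nonneg (Real.exp_pos t).le (h.fst_nonneg t)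
  have h3 := mul_le_mul_of_nonneg_right (le_abs_self R) (Real.exp_pos t).le
  linarith

lemma tendsto_fst_atTop (h : IsConfinedOrbit a b c p q) (hab : 0 < a + b) (hc : 0 < c) :
    Tendsto p atTop (𝓝 0) := by
  rw [tendsto_order]
  refine ⟨fun Q hQ => Eventually.of_forall fun t => hQ.trans_le (h.fst_nonneg t),
    fun Q hQ => ?_⟩
  -- Once q < Q / 2, u - (Q/2) x no longer increases; dividing by a large x gives p < Q.
  have hex : ∃ s, q s < Q / 2 := by
    by_contra! hge
    exact h.not_forall_snd_mem_Icc hab (half_pos hQ) (s := 0) fun t _ =>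
      ⟨hge t, h.snd_le_one hab hc t⟩
  obtain ⟨s, hs⟩ := hex
  have hlim : Tendsto (fun t : ℝ => Real.exp t * (Q / 2)) atTop atTop :=
    Real.tendsto_exp_atTop.atTop_mul_const (half_pos hQ)
  filter_upwards [eventually_ge_atTop s, hlim.eventually_gt_atTop (Real.exp s)] with t hst ht
  have h1 := sub_le_mul_sub_of_deriv_le (k := 0) hst
    (fun τ _ => h.hasDerivAt_exp_mul_sub (Q / 2) τ)
    (fun τ hτ => mul_nonpos_of_nonneg_of_nonpos (Real.exp_pos τ).le (by
      linarith [(h.snd_strictAnti hab hc).antitone hτ.1]))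
  have h2 : Real.exp s * (p s - Q / 2) ≤ Real.exp s :=
    mul_le_of_le_one_right (Real.exp_pos s).le (by linarith [h.fst_le_one s])
  by_contra! hQp
  have h3 := mul_le_mul_of_nonneg_left hQp (Real.exp_pos t).le
  linarith

/-! ### Comparison of two confined orbits -/

lemma fst_le_fst (h : IsConfinedOrbit a b c p q) {p' q' : ℝ → ℝ}
    (h' : IsConfinedOrbit a b c p' q') (hab : 0 < a + b) (hc : 0 < c) (t : ℝ) : p t ≤ p' t := by
  by_contra! hlt
  let z : ℝ → ℝ := fun t => p t - p' t
  have hz : Continuous z := h.continuous_fst.sub h'.continuous_fst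
  have hpos : 0 < z t := sub_pos.2 hlt
  have hbot : Tendsto z atBot (𝓝 0) := by
    simpa using (h.tendsto_fst_atBot hab hc).sub (h'.tendsto_fst_atBot hab hc)
  have htop : Tendsto z atTop (𝓝 0) := by
    simpa using (h.tendsto_fst_atTop hab hc).sub (h'.tendsto_fst_atTop hab hc)
  -- A positive value together with zero limits at ±∞ forces a global maximum.
  obtain ⟨s, hs⟩ := hz.exists_forall_ge' t (by
    rw [cocompact_eq_atBot_atTop, eventually_sup]
    exact ⟨hbot.eventually (ge_mem_nhds hpos), htop.eventually (ge_mem_nhds hpos)⟩)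
  have hzs : 0 < z s := hpos.trans_le (hs t)
  let w : ℝ → ℝ := fun t => (q t - p t) - (q' t - p' t)
  have hdz : ∀ t, HasDerivAt z (w t) t := fun t =>
    (h.hasDerivAt_fst t).sub (h'.hasDerivAt_fst t)
  have hws : w s = 0 :=
    IsLocalMax.hasDerivAt_eq_zero (Eventually.of_forall hs) (hdz s)
  have hdw : HasDerivAt w ((slopeRate a b c p q s - (q s - p s))
      - (slopeRate a b c p' q' s - (q' s - p' s))) s :=
    ((h.hasDerivAt_snd s).sub (h.hasDerivAt_fst s)).sub
      ((h'.hasDerivAt_snd s).sub (h'.hasDerivAt_fst s))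
  have hqz : q s - q' s = z s := by simp only [w, z] at hws ⊢; linarith
  have hposd : 0 < (slopeRate a b c p q s - (q s - p s))
      - (slopeRate a b c p' q' s - (q' s - p' s)) := by
    -- At the maximum z' = 0, so q - q' = p - p' = z; the quadratic terms factor, and q, q' ≤ 1
    -- gives them the favourable sign.
    have e : (slopeRate a b c p q s - (q s - p s)) - (slopeRate a b c p' q' s - (q' s - p' s))
        = (a + b) * z s + c * Real.exp (-s) * (z s * (2 - q s - q' s)) := by
      have e1 : q s = q' s + z s := by linarith
      have e2 : p s = p' s + z s := by simp only [z]; ring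
      simp only [slopeRate, e1, e2]
      ring
    rw [e]
    have h1 := h.snd_le_one hab hc s
    have h2 := h'.snd_le_one hab hc s
    have := mul_nonneg (mul_pos hc (Real.exp_pos (-s))).le
      (mul_nonneg hzs.le (show 0 ≤ 2 - q s - q' s by linarith))
    linarith [mul_pos hab hzs]
  obtain ⟨δ, hδ, hr, -⟩ := hdw.exists_forall_Ioo_lt hposd
  have := lt_of_deriv_pos_of_Ioo (show s < s + δ / 2 by linarith) (fun τ _ => hdz τ)
    (fun τ hτ => by
      have := hr τ ⟨hτ.1, by linarith [hτ.2]⟩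
      rwa [hws] at this)
  linarith [hs (s + δ / 2)]

end IsConfinedOrbit

/-! ### Positivity of the third derivative -/

namespace IsConfinedOrbit

variable {a b c : ℝ} {p q : ℝ → ℝ}

lemma hasDerivAt_third (h : IsConfinedOrbit a b c p q) (t : ℝ) :
    HasDerivAt (thirdRate a b c p q)
      (slopeRate a b c p q t * thirdForcing a b c p q t
        + (slopeDamping a c q t - 1) * thirdRate a b c p q t) t :=
  hasDerivAt_thirdRate (h.hasDerivAt_fst t) (h.hasDerivAt_snd t)

lemma hasDerivAt_forcing (h : IsConfinedOrbit a b c p q) (t : ℝ) :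
    HasDerivAt (thirdForcing a b c p q) (-2 * c * Real.exp (-t) * thirdRate a b c p q t) t :=
  hasDerivAt_thirdForcing (h.hasDerivAt_fst t) (h.hasDerivAt_snd t)

lemma continuous_third (h : IsConfinedOrbit a b c p q) : Continuous (thirdRate a b c p q) :=
  continuous_iff_continuousAt.2 fun t => (h.hasDerivAt_third t).continuousAt

lemma hasDerivAt_exp_mul_rate (h : IsConfinedOrbit a b c p q) (t : ℝ) :
    HasDerivAt (fun t => Real.exp (-t) * slopeRate a b c p q t)
      (Real.exp (-t) * thirdRate a b c p q t) t := by
  refine ((hasDerivAt_exp_neg t).mul (h.hasDerivAt_rate t)).congr_deriv ?_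
  simp only [thirdRate]
  ring

/-- The slope of an orbit is not concave, as a function of `x`, near infinity. -/
lemma exists_third_pos_right (h : IsConfinedOrbit a b c p q) (hab : 0 < a + b) (hc : 0 < c)
    (s : ℝ) : ∃ t, s ≤ t ∧ 0 < thirdRate a b c p q t := by
  by_contra! hle
  have hr := h.rate_neg hab hc s
  -- Here u'' = e^{-t} r is nonincreasing, so r ≤ r s < 0 and q would lose 1 within time -1 / r s.
  have hbound : ∀ t, s ≤ t → slopeRate a b c p q t ≤ slopeRate a b c p q s := by
    intro t ht
    have h1 := sub_le_mul_sub_of_deriv_le (k := 0) ht (fun τ _ => h.hasDerivAt_exp_mul_rate τ)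
      (fun τ hτ => mul_nonpos_of_nonneg_of_nonpos (Real.exp_pos (-τ)).le (hle τ hτ.1))
    have h2 : Real.exp (-t) ≤ Real.exp (-s) := Real.exp_le_exp.2 (by linarith)
    by_contra! hgt
    have h3 := mul_lt_mul_of_pos_left hgt (Real.exp_pos (-t))
    have h4 := mul_le_mul_of_nonpos_right h2 hr.le
    linarith
  have hpos : 0 < 1 / - slopeRate a b c p q s := div_pos one_pos (by linarith)
  have := sub_le_mul_sub_of_deriv_le (k := slopeRate a b c p q s)
    (show s ≤ s + 1 / - slopeRate a b c p q s by linarith) (fun τ _ => h.hasDerivAt_snd τ)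
    (fun τ hτ => hbound τ hτ.1)
  have e : slopeRate a b c p q s * (s + 1 / - slopeRate a b c p q s - s) = -1 := by
    have := hr.ne
    field_simp
    ring
  rw [e] at this
  linarith [h.snd_le_one hab hc s, h.snd_pos hab hc (s + 1 / - slopeRate a b c p q s)]

/-- The slope of an orbit is not concave, as a function of `x`, near zero. -/
lemma exists_third_pos_left (h : IsConfinedOrbit a b c p q) (hab : 0 < a + b) (hc : 0 < c)
    (s : ℝ) : ∃ t, t ≤ s ∧ 0 < thirdRate a b c p q t := by
  by_contra! hle
  set M := -(Real.exp (-s) * slopeRate a b c p q s) with hM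
  have hM0 : 0 < M := by
    have := mul_neg_of_pos_of_neg (Real.exp_pos (-s)) (h.rate_neg hab hc s)
    linarith
  have hbound : ∀ t, t ≤ s → -(M * Real.exp t) ≤ slopeRate a b c p q t := by
    intro t ht
    have h1 := sub_le_mul_sub_of_deriv_le (k := 0) ht (fun τ _ => h.hasDerivAt_exp_mul_rate τ)
      (fun τ hτ => mul_nonpos_of_nonneg_of_nonpos (Real.exp_pos (-τ)).le (hle τ hτ.2))
    have h2 := mul_le_mul_of_nonneg_left (show -M ≤ Real.exp (-t) * slopeRate a b c p q t by
      linarith) (Real.exp_pos t).le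
    rw [← mul_assoc, ← Real.exp_add, add_neg_cancel, Real.exp_zero, one_mul] at h2
    linarith
  have hsnd : ∀ t, t ≤ s → 1 - q t ≤ M * Real.exp t := by
    intro t ht
    have hlim : Tendsto (fun τ => q τ + M * Real.exp τ) atBot (𝓝 (1 + M * 0)) :=
      (h.tendsto_snd_atBot hab hc).add (Real.tendsto_exp_atBot.const_mul M)
    rw [mul_zero, add_zero] at hlim
    have : 1 ≤ q t + M * Real.exp t := by
      refine le_of_tendsto hlim ?_
      filter_upwards [eventually_le_atBot t] with τ hτ
      have := mul_sub_le_sub_of_le_deriv (k := 0) hτ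
        (fun x _ => (h.hasDerivAt_snd x).add ((Real.hasDerivAt_exp x).const_mul M))
        (fun x hx => by linarith [hbound x (hx.2.trans ht)])
      simp only [Pi.add_apply] at this
      linarith
    linarith
  -- Since u'' ≥ -M gives 1 - q ≤ M e^t, the quadratic term is at most c M² e^t; this lower bound
  -- for r tends to a + b > 0.
  have hlim : Tendsto (fun t => a * q t + b * p t - c * M ^ 2 * Real.exp t) atBot
      (𝓝 (a * 1 + b * 1 - c * M ^ 2 * 0)) :=
    (((h.tendsto_snd_atBot hab hc).const_mul a).add
      ((h.tendsto_fst_atBot hab hc).const_mul b)).sub (Real.tendsto_exp_atBot.const_mul _)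
  obtain ⟨t, ht, hts⟩ := ((hlim.eventually (lt_mem_nhds
    (show (0 : ℝ) < a * 1 + b * 1 - c * M ^ 2 * 0 by linarith))).and
    (eventually_le_atBot s)).exists
  have h1 := hsnd t hts
  have h2 := h.snd_le_one hab hc t
  have h3 : (q t - 1) ^ 2 ≤ (M * Real.exp t) ^ 2 := by nlinarith
  have h4 := mul_le_mul_of_nonneg_left h3 (mul_pos hc (Real.exp_pos (-t))).le
  have h5 : c * Real.exp (-t) * (M * Real.exp t) ^ 2 = c * M ^ 2 * Real.exp t := by
    have : Real.exp (-t) * Real.exp t = 1 := by rw [← Real.exp_add]; simp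
    linear_combination c * M ^ 2 * Real.exp t * this
  have h6 := h.rate_neg hab hc t
  simp only [slopeRate] at h6
  linarith

/-- On a component (x₁, x₂) of {y < 0}, the forcing n strictly increases. At x₂, y' = r n ≥ 0 with r
< 0 forces n ≤ 0; hence n < 0 at x₁, so y' > 0 there and y becomes positive inside the component. -/
lemma third_nonneg (h : IsConfinedOrbit a b c p q) (hab : 0 < a + b) (hc : 0 < c) (s : ℝ) :
    0 ≤ thirdRate a b c p q s := by
  by_contra! hs
  set y := thirdRate a b c p q with hy
  have hyc : Continuous y := h.continuous_third
  obtain ⟨l, hls, hl⟩ := h.exists_third_pos_left hab hc s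
  obtain ⟨m, hsm, hm⟩ := h.exists_third_pos_right hab hc s
  -- the connected component of `s` in `{y < 0}` is `(x₁, x₂)`
  have hA : IsCompact {t ∈ Icc l s | 0 ≤ y t} :=
    isCompact_Icc.inter_right (isClosed_le continuous_const hyc)
  have hB : IsCompact {t ∈ Icc s m | 0 ≤ y t} :=
    isCompact_Icc.inter_right (isClosed_le continuous_const hyc)
  obtain ⟨x₁, ⟨⟨hx₁l, hx₁s⟩, hyx₁⟩, hmax⟩ :=
    hA.exists_isGreatest ⟨l, left_mem_Icc.2 hls, hl.le⟩
  obtain ⟨x₂, ⟨⟨hx₂s, hx₂m⟩, hyx₂⟩, hmin⟩ :=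
    hB.exists_isLeast ⟨m, right_mem_Icc.2 hsm, hm.le⟩
  have hneg : ∀ t ∈ Ioo x₁ x₂, y t < 0 := by
    intro t ht
    by_contra! h0
    rcases le_total t s with hts | hts
    · exact absurd (hmax ⟨⟨hx₁l.trans ht.1.le, hts⟩, h0⟩) (not_le.2 ht.1)
    · exact absurd (hmin ⟨⟨hts, ht.2.le.trans hx₂m⟩, h0⟩) (not_le.2 ht.2)
  have hx₁s' : x₁ < s := hx₁s.lt_of_ne (fun e => by rw [e] at hyx₁; linarith)
  have hx₂s' : s < x₂ := hx₂s.lt_of_ne (fun e => by rw [← e] at hyx₂; linarith)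
  have hx : x₁ < x₂ := hx₁s'.trans hx₂s'
  have hyx₁0 : y x₁ = 0 := by
    refine le_antisymm ?_ hyx₁
    have hT : Tendsto y (𝓝[>] x₁) (𝓝 (y x₁)) := hyc.continuousAt.continuousWithinAt
    refine le_of_tendsto hT ?_
    filter_upwards [Ioo_mem_nhdsGT hx] with t ht using (hneg t ht).le
  have hyx₂0 : y x₂ = 0 := by
    refine le_antisymm ?_ hyx₂
    have hT : Tendsto y (𝓝[<] x₂) (𝓝 (y x₂)) := hyc.continuousAt.continuousWithinAt
    refine le_of_tendsto hT ?_
    filter_upwards [Ioo_mem_nhdsLT hx] with t ht using (hneg t ht).le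
  have hn₂ : thirdForcing a b c p q x₂ ≤ 0 := by
    by_contra! hn
    have hd := h.hasDerivAt_third x₂
    rw [← hy, hyx₂0, mul_zero, add_zero] at hd
    obtain ⟨δ, hδ, -, hgt⟩ :=
      hd.exists_forall_Ioo_gt (mul_neg_of_neg_of_pos (h.rate_neg hab hc x₂) hn)
    have hmx : max s (x₂ - δ / 2) < x₂ := max_lt hx₂s' (by linarith)
    have h1 := hgt (max s (x₂ - δ / 2)) ⟨by linarith [le_max_right s (x₂ - δ / 2)], hmx⟩
    have h2 := hneg (max s (x₂ - δ / 2)) ⟨hx₁s'.trans_le (le_max_left _ _), hmx⟩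
    linarith
  have hn₁ : thirdForcing a b c p q x₁ < 0 := by
    refine (lt_of_deriv_pos_of_Ioo hx (fun τ _ => h.hasDerivAt_forcing τ)
      fun τ hτ => ?_).trans_le hn₂
    have := mul_pos_of_neg_of_neg
      (neg_neg_of_pos (mul_pos (mul_pos two_pos hc) (Real.exp_pos (-τ)))) (hneg τ hτ)
    linarith
  have hd := h.hasDerivAt_third x₁
  rw [← hy, hyx₁0, mul_zero, add_zero] at hd
  obtain ⟨δ, hδ, hlt, -⟩ :=
    hd.exists_forall_Ioo_lt (mul_pos_of_neg_of_neg (h.rate_neg hab hc x₁) hn₁)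
  have hmx : x₁ < min s (x₁ + δ / 2) := lt_min hx₁s' (by linarith)
  have h1 := hlt (min s (x₁ + δ / 2)) ⟨hmx, by linarith [min_le_right s (x₁ + δ / 2)]⟩
  have h2 := hneg (min s (x₁ + δ / 2)) ⟨hmx, (min_le_left _ _).trans_lt hx₂s'⟩
  linarith

/-- A zero of y is a minimum, so y' = r n = 0 and n = 0 too; linear uniqueness then makes y vanish
to the right, contradicting `exists_third_pos_right`. -/
lemma third_pos (h : IsConfinedOrbit a b c p q) (hab : 0 < a + b) (hc : 0 < c) (s : ℝ) :
    0 < thirdRate a b c p q s := by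
  refine (h.third_nonneg hab hc s).lt_of_ne' fun h0 => ?_
  have hd := IsLocalMin.hasDerivAt_eq_zero
    (Eventually.of_forall fun t => by rw [h0]; exact h.third_nonneg hab hc t)
    (h.hasDerivAt_third s)
  rw [h0, mul_zero, add_zero, mul_eq_zero] at hd
  have hn := hd.resolve_left (h.rate_neg hab hc s).ne
  obtain ⟨t, hst, ht⟩ := h.exists_third_pos_right hab hc s
  have := planar_linear_eq_zero (α := fun t => slopeDamping a c q t - 1)
    (β := slopeRate a b c p q) (γ := fun t => -2 * c * Real.exp (-t)) (δ := fun _ => 0)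
    (left_mem_Icc.2 hst) (h.continuous_damping.sub continuous_const).continuousOn
    h.continuous_rate.continuousOn (by fun_prop) continuousOn_const
    (fun τ _ => (h.hasDerivAt_third τ).congr_deriv (by ring))
    (fun τ _ => (h.hasDerivAt_forcing τ).congr_deriv (by ring)) h0 hn t (right_mem_Icc.2 hst)
  linarith [this.1]

end IsConfinedOrbit

/-! ### Global flows of bounded Lipschitz fields -/

section GlobalFlow

variable {E : Type*} [NormedAddCommGroup E] [NormedSpace ℝ E] {f : ℝ → E → E}

/-- Vector fields which are bounded and Lipschitz in space, uniformly on compact time intervals. -/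
structure IsLocallyUniformField (f : ℝ → E → E) : Prop where
  continuous_left : ∀ y, Continuous fun t => f t y
  bound : ∀ T : ℝ, ∃ K L : ℝ≥0, ∀ t ∈ Icc (-T) T, LipschitzWith K (f t) ∧ ∀ y, ‖f t y‖ ≤ L

lemma IsLocallyUniformField.exists_hasDerivAt [CompleteSpace E] (hf : IsLocallyUniformField f)
    (t₀ : ℝ) (y₀ : E) : ∃ α : ℝ → E, α t₀ = y₀ ∧ ∀ t, HasDerivAt α (f t (α t)) t := by
  obtain ⟨N, hN⟩ := exists_nat_gt |t₀|
  have hex : ∀ n : ℕ, ∃ α : ℝ → E, α t₀ = y₀ ∧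
      ∀ t ∈ Ioo (-((N + n : ℕ) : ℝ)) ((N + n : ℕ) : ℝ), HasDerivAt α (f t (α t)) t := by
    intro n
    set T : ℝ := ((N + n : ℕ) : ℝ) with hT
    have hNT : (N : ℝ) ≤ T := by rw [hT]; exact_mod_cast Nat.le_add_right N n
    have ht₀ : t₀ ∈ Icc (-T) T := abs_le.1 (hN.le.trans hNT)
    have hT0 : 0 ≤ T := by rw [hT]; positivity
    obtain ⟨K, L, hKL⟩ := hf.bound T
    -- Radius L · 2T suffices: speed is at most L and no time in [-T, T] is farther than 2T from t₀.
    have hpl : IsPicardLindelof f (⟨t₀, ht₀⟩ : Icc (-T) T) y₀ (L * (2 * ⟨T, hT0⟩)) 0 L K :=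
      { lipschitzOnWith := fun t ht => (hKL t ht).1.lipschitzOnWith
        continuousOn := fun y _ => (hf.continuous_left y).continuousOn
        norm_le := fun t ht y _ => (hKL t ht).2 y
        mul_max_le := by
          push_cast
          rw [sub_zero]
          refine mul_le_mul_of_nonneg_left (max_le ?_ ?_) L.2
          · change T - t₀ ≤ 2 * T
            linarith [ht₀.1]
          · change t₀ - -T ≤ 2 * T
            linarith [ht₀.2] }
    obtain ⟨α, h0, hα⟩ := hpl.exists_eq_forall_mem_Icc_hasDerivWithinAt₀
    exact ⟨α, h0, fun t ht => (hα t (Ioo_subset_Icc_self ht)).hasDerivAt (Icc_mem_nhds ht.1 ht.2)⟩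
  choose α h0 hα using hex
  have heq : ∀ m n : ℕ, m ≤ n → EqOn (α m) (α n) (Ioo (-((N + m : ℕ) : ℝ)) ((N + m : ℕ) : ℝ)) := by
    intro m n hmn
    have hle : ((N + m : ℕ) : ℝ) ≤ (N + n : ℕ) := by exact_mod_cast Nat.add_le_add_left hmn N
    obtain ⟨K, L, hKL⟩ := hf.bound (N + m : ℕ)
    refine ODE_solution_unique_of_mem_Ioo (v := f) (s := fun _ => univ) (K := K) (t₀ := t₀)
      (fun t ht => (hKL t (Ioo_subset_Icc_self ht)).1.lipschitzOnWith) ?_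
      (fun t ht => ⟨hα m t ht, trivial⟩)
      (fun t ht => ⟨hα n t (Ioo_subset_Ioo (neg_le_neg hle) hle ht), trivial⟩) ?_
    · have : (N : ℝ) ≤ (N + m : ℕ) := by exact_mod_cast Nat.le_add_right N m
      exact abs_lt.1 (hN.trans_le this)
    · rw [h0, h0]
  have hmem : ∀ t : ℝ, ∀ n : ℕ, |t| < n → t ∈ Ioo (-((N + n : ℕ) : ℝ)) ((N + n : ℕ) : ℝ) := by
    intro t n h
    have : (n : ℝ) ≤ (N + n : ℕ) := by exact_mod_cast Nat.le_add_left n N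
    exact abs_lt.1 (h.trans_le this)
  -- The local solutions agree on overlaps; the index ⌈|t|⌉₊ + 1 puts t strictly inside its
  -- interval.
  refine ⟨fun t => α (⌈|t|⌉₊ + 1) t, h0 _, fun t => ?_⟩
  have hlt : ∀ s : ℝ, |s| < (⌈|s|⌉₊ + 1 : ℕ) := fun s => by
    push_cast
    exact (Nat.le_ceil |s|).trans_lt (lt_add_one _)
  obtain ⟨n, hn⟩ := exists_nat_gt (|t| + 1)
  have hev : (fun s => α (⌈|s|⌉₊ + 1) s) =ᶠ[𝓝 t] α n := by
    filter_upwards [Metric.ball_mem_nhds t one_pos] with s hs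
    rw [Metric.mem_ball, Real.dist_eq] at hs
    have hs' : |s| < n := by
      have := abs_sub_abs_le_abs_sub s t
      linarith
    rcases le_total n (⌈|s|⌉₊ + 1) with h | h
    · exact (heq _ _ h (hmem s n hs')).symm
    · exact heq _ _ h (hmem s _ (hlt s))
  have := hα n t (hmem t n (by linarith))
  rw [← hev.eq_of_nhds] at this
  exact this.congr_of_eventuallyEq hev

/-- Grönwall forwards and, after time reversal, backwards. The constant is the same for all pairs of
trajectories. -/
lemma IsLocallyUniformField.dist_le (hf : IsLocallyUniformField f) (T : ℝ) :
    ∃ C : ℝ, 0 < C ∧ ∀ α β : ℝ → E, (∀ t, HasDerivAt α (f t (α t)) t) →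
      (∀ t, HasDerivAt β (f t (β t)) t) → ∀ s ∈ Icc (-T) T, ∀ t ∈ Icc (-T) T,
        dist (α t) (β t) ≤ C * dist (α s) (β s) := by
  obtain ⟨K, L, hKL⟩ := hf.bound T
  refine ⟨Real.exp (K * (2 * T)), Real.exp_pos _, fun α β hα hβ s hs t ht => ?_⟩
  have hmono : ∀ x : ℝ, x ≤ 2 * T → dist (α s) (β s) * Real.exp (K * x) ≤
      Real.exp (K * (2 * T)) * dist (α s) (β s) := fun x hx => by
    rw [mul_comm]
    exact mul_le_mul_of_nonneg_right
      (Real.exp_le_exp.2 (mul_le_mul_of_nonneg_left hx K.2)) dist_nonneg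
  rcases le_total s t with h | h
  · refine (dist_le_of_trajectories_ODE_of_mem (v := f) (s := fun _ => univ) (K := K) (a := s)
      (b := t) (fun τ hτ => (hKL τ ⟨hs.1.trans hτ.1, hτ.2.le.trans ht.2⟩).1.lipschitzOnWith)
      (fun τ _ => (hα τ).continuousAt.continuousWithinAt) (fun τ _ => (hα τ).hasDerivWithinAt)
      (fun _ _ => trivial) (fun τ _ => (hβ τ).continuousAt.continuousWithinAt)
      (fun τ _ => (hβ τ).hasDerivWithinAt) (fun _ _ => trivial) le_rfl t
      (right_mem_Icc.2 h)).trans (hmono _ (by linarith [hs.1, ht.2]))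
  · have hrev : ∀ γ : ℝ → E, (∀ t, HasDerivAt γ (f t (γ t)) t) →
        ∀ t, HasDerivAt (fun t => γ (-t)) (-f (-t) (γ (-t))) t := fun γ hγ t => by
      simpa [Function.comp_def] using (hγ (-t)).scomp t (hasDerivAt_neg t)
    have := dist_le_of_trajectories_ODE_of_mem (v := fun t y => -f (-t) y) (s := fun _ => univ)
      (K := K) (a := -s) (b := -t) (f := fun t => α (-t)) (g := fun t => β (-t))
      (δ := dist (α s) (β s))
      (fun τ hτ => ((hKL (-τ) ⟨by linarith [hτ.2, ht.1], by linarith [hτ.1, hs.2]⟩).1.neg).lipschitzOnWith)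
      (fun τ _ => (hrev α hα τ).continuousAt.continuousWithinAt)
      (fun τ _ => (hrev α hα τ).hasDerivWithinAt)
      (fun _ _ => trivial) (fun τ _ => (hrev β hβ τ).continuousAt.continuousWithinAt)
      (fun τ _ => (hrev β hβ τ).hasDerivWithinAt) (fun _ _ => trivial) (by simp) (-t)
      (right_mem_Icc.2 (neg_le_neg h))
    simp only [neg_neg] at this
    exact this.trans (hmono _ (by linarith [hs.2, ht.1]))

end GlobalFlow

/-! ### The truncated planar field -/

/-- Projection of `ℝ` onto `[-1, 2]`. -/
noncomputable def truncate (x : ℝ) : ℝ := max (-1) (min x 2)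

lemma truncate_mem (x : ℝ) : -1 ≤ truncate x ∧ truncate x ≤ 2 :=
  ⟨le_max_left _ _, max_le (by norm_num) (min_le_right _ _)⟩

lemma truncate_of_mem {x : ℝ} (h1 : -1 ≤ x) (h2 : x ≤ 2) : truncate x = x := by
  rw [truncate, min_eq_left h2, max_eq_right h1]

lemma abs_truncate_sub_le (x y : ℝ) : |truncate x - truncate y| ≤ |x - y| := by
  refine (abs_max_sub_max_le_max _ _ _ _).trans (max_le (by simp) ?_)
  exact (abs_min_sub_min_le_max _ _ _ _).trans (max_le le_rfl (by simp))

lemma continuous_truncate : Continuous truncate := by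
  unfold truncate; fun_prop

/-- The vector field of the planar system, with both unknowns truncated to `[-1, 2]`. -/
noncomputable def truncatedField (a b c t : ℝ) (y : ℝ × ℝ) : ℝ × ℝ :=
  (truncate y.2 - truncate y.1,
    a * truncate y.2 + b * truncate y.1 - c * Real.exp (-t) * (truncate y.2 - 1) ^ 2)

lemma continuous_truncatedField (a b c : ℝ) :
    Continuous fun x : ℝ × ℝ × ℝ => truncatedField a b c x.1 x.2 := by
  have := continuous_truncate
  unfold truncatedField
  fun_prop

lemma isLocallyUniformField_truncatedField {a b c : ℝ} (hc : 0 < c) :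
    IsLocallyUniformField (truncatedField a b c) where
  continuous_left y :=
    (continuous_truncatedField a b c).comp (continuous_id.prodMk continuous_const)
  bound T := by
    set M := c * Real.exp T with hM
    have hM0 : 0 < M := mul_pos hc (Real.exp_pos T)
    have hcM : ∀ t ∈ Icc (-T) T, c * Real.exp (-t) ≤ M := fun t ht =>
      mul_le_mul_of_nonneg_left (Real.exp_le_exp.2 (by linarith [ht.1])) hc.le
    refine ⟨NNReal.mk (2 + |a| + |b| + 4 * M) (by positivity),
      NNReal.mk (3 + 2 * |a| + 2 * |b| + 4 * M) (by positivity),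
      fun t ht => ⟨LipschitzWith.of_dist_le_mul fun y z => ?_, fun y => ?_⟩⟩
    · rw [Prod.dist_eq, NNReal.coe_mk]
      set d := dist y z with hd
      have hd0 : 0 ≤ d := dist_nonneg
      have h1 : |truncate y.1 - truncate z.1| ≤ d :=
        (abs_truncate_sub_le _ _).trans (le_max_left _ _)
      have h2 : |truncate y.2 - truncate z.2| ≤ d :=
        (abs_truncate_sub_le _ _).trans (le_max_right _ _)
      obtain ⟨y1, y2⟩ := truncate_mem y.2
      obtain ⟨z1, z2⟩ := truncate_mem z.2
      have ha : |a * (truncate y.2 - truncate z.2)| ≤ |a| * d := by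
        rw [abs_mul]; exact mul_le_mul_of_nonneg_left h2 (abs_nonneg a)
      have hb : |b * (truncate y.1 - truncate z.1)| ≤ |b| * d := by
        rw [abs_mul]; exact mul_le_mul_of_nonneg_left h1 (abs_nonneg b)
      have hs : |c * Real.exp (-t) * ((truncate y.2 + truncate z.2 - 2)
          * (truncate y.2 - truncate z.2))| ≤ M * (4 * d) := by
        rw [abs_mul, abs_mul _ (truncate y.2 - truncate z.2),
          abs_of_pos (mul_pos hc (Real.exp_pos (-t)))]
        refine mul_le_mul (hcM t ht) (mul_le_mul ?_ h2 (abs_nonneg _) (by norm_num))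
          (by positivity) hM0.le
        rw [abs_le]; constructor <;> linarith
      have hMd := mul_nonneg hM0.le hd0
      have had := mul_nonneg (abs_nonneg a) hd0
      have hbd := mul_nonneg (abs_nonneg b) hd0
      rw [abs_le] at h1 h2 ha hb hs
      refine max_le ?_ ?_
      · rw [Real.dist_eq, abs_le]
        simp only [truncatedField]
        constructor <;> linarith [h1.1, h1.2, h2.1, h2.2]
      · rw [Real.dist_eq, abs_le]
        simp only [truncatedField]
        constructor <;> linarith [ha.1, ha.2, hb.1, hb.2, hs.1, hs.2]
    · rw [Prod.norm_def, NNReal.coe_mk]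
      obtain ⟨p1, p2⟩ := truncate_mem y.1
      obtain ⟨q1, q2⟩ := truncate_mem y.2
      have hp : |truncate y.1| ≤ 2 := abs_le.2 ⟨by linarith, p2⟩
      have hq : |truncate y.2| ≤ 2 := abs_le.2 ⟨by linarith, q2⟩
      have ha : |a * truncate y.2| ≤ |a| * 2 := by
        rw [abs_mul]; exact mul_le_mul_of_nonneg_left hq (abs_nonneg a)
      have hb : |b * truncate y.1| ≤ |b| * 2 := by
        rw [abs_mul]; exact mul_le_mul_of_nonneg_left hp (abs_nonneg b)
      have hs0 : 0 ≤ c * Real.exp (-t) * (truncate y.2 - 1) ^ 2 := by positivity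
      have hs : c * Real.exp (-t) * (truncate y.2 - 1) ^ 2 ≤ M * 4 :=
        mul_le_mul (hcM t ht) (by nlinarith) (sq_nonneg _) hM0.le
      rw [abs_le] at ha hb
      have a0 := abs_nonneg a
      have b0 := abs_nonneg b
      refine max_le ?_ ?_
      · rw [Real.norm_eq_abs, abs_le]
        simp only [truncatedField]
        constructor <;> linarith
      · rw [Real.norm_eq_abs, abs_le]
        simp only [truncatedField]
        constructor <;> linarith [ha.1, ha.2, hb.1, hb.2]

/-! ### Shooting from the diagonal -/

section Shooting

variable {a b c : ℝ} {α : ℝ → ℝ × ℝ}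

/-- While the slope stays in `[0, 1]`, the first component cannot leave `[0, 1]`. -/
lemma fst_mem_Icc_of_snd_mem_Icc (hα : ∀ t, HasDerivAt α (truncatedField a b c t (α t)) t)
    {s t : ℝ} (hst : s ≤ t) (hs : (α s).1 ∈ Icc (0 : ℝ) 1)
    (hq : ∀ τ ∈ Icc s t, (α τ).2 ∈ Icc (0 : ℝ) 1) : (α t).1 ∈ Icc (0 : ℝ) 1 := by
  have hd : ∀ τ, HasDerivAt (fun τ => (α τ).1) (truncate (α τ).2 - truncate (α τ).1) τ :=
    fun τ => (hasFDerivAt_fst (p := α τ)).comp_hasDerivAt τ (hα τ)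
  have hcont : Continuous fun τ => (α τ).1 :=
    continuous_iff_continuousAt.2 fun τ => (hd τ).continuousAt
  have htr : ∀ τ ∈ Ico s t, truncate (α τ).2 = (α τ).2 := fun τ hτ =>
    truncate_of_mem (by linarith [(hq τ (Ico_subset_Icc_self hτ)).1])
      (by linarith [(hq τ (Ico_subset_Icc_self hτ)).2])
  constructor
  · refine le_of_forall_pos_le_add fun δ hδ => ?_
    have := image_le_of_deriv_right_lt_deriv_boundary' (f := fun τ => -(α τ).1)
      (B := fun _ => δ) (B' := fun _ => 0) hcont.neg.continuousOn
      (fun τ _ => (hd τ).neg.hasDerivWithinAt) (by linarith [hs.1]) continuousOn_const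
      (fun τ _ => hasDerivWithinAt_const _ _ _) (fun τ hτ he => by
        have he' : (α τ).1 = -δ := by linarith
        -- Truncation levels strictly outside [0, 1] keep this inequality strict, so p is pushed
        -- back at the barrier -δ.
        have hneg : truncate (-δ) < 0 := max_lt (by norm_num) ((min_le_left _ _).trans_lt (by linarith))
        rw [htr τ hτ, he']
        linarith [(hq τ (Ico_subset_Icc_self hτ)).1]) (right_mem_Icc.2 hst)
    linarith
  · refine le_of_forall_pos_le_add fun δ hδ => ?_
    exact image_le_of_deriv_right_lt_deriv_boundary' (f := fun τ => (α τ).1)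
      (B := fun _ => 1 + δ) (B' := fun _ => 0) hcont.continuousOn
      (fun τ _ => (hd τ).hasDerivWithinAt) (by linarith [hs.2]) continuousOn_const
      (fun τ _ => hasDerivWithinAt_const _ _ _) (fun τ hτ he => by
        have hneg : 1 < truncate (1 + δ) :=
          (lt_min (by linarith) (by norm_num)).trans_le (le_max_right _ _)
        rw [htr τ hτ, he]
        linarith [(hq τ (Ico_subset_Icc_self hτ)).2]) (right_mem_Icc.2 hst)

lemma hasDerivAt_components (hα : ∀ t, HasDerivAt α (truncatedField a b c t (α t)) t) {t : ℝ}
    (hp : (α t).1 ∈ Icc (0 : ℝ) 1) (hq : (α t).2 ∈ Icc (0 : ℝ) 1) :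
    HasDerivAt (fun t => (α t).1) ((α t).2 - (α t).1) t ∧
      HasDerivAt (fun t => (α t).2)
        (slopeRate a b c (fun t => (α t).1) (fun t => (α t).2) t) t := by
  have h1 := (hasFDerivAt_fst (𝕜 := ℝ) (p := α t)).comp_hasDerivAt t (hα t)
  have h2 := (hasFDerivAt_snd (𝕜 := ℝ) (p := α t)).comp_hasDerivAt t (hα t)
  have e1 : truncate (α t).1 = (α t).1 :=
    truncate_of_mem (by linarith [hp.1]) (by linarith [hp.2])
  have e2 : truncate (α t).2 = (α t).2 :=
    truncate_of_mem (by linarith [hq.1]) (by linarith [hq.2])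
  refine ⟨h1.congr_deriv ?_, h2.congr_deriv ?_⟩
  · simp [truncatedField, e1, e2]
  · simp [truncatedField, e1, e2, slopeRate]

/-- A trajectory starting on the diagonal of `[0, 1]²` at which neither the slope nor its
derivative is the first to change sign remains in `[0, 1]²`. -/
lemma forall_mem_of_not_exit (hab : 0 < a + b) (hc : 0 < c)
    (hα : ∀ t, HasDerivAt α (truncatedField a b c t (α t)) t) {s : ℝ}
    (hs : (α s).1 ∈ Icc (0 : ℝ) 1) (hdiag : (α s).1 = (α s).2)
    (hdown : ¬ ∃ t, s ≤ t ∧ (α t).2 < 0 ∧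
      ∀ τ ∈ Icc s t, (truncatedField a b c τ (α τ)).2 < 0)
    (hup : ¬ ∃ t, s ≤ t ∧ 0 < (truncatedField a b c t (α t)).2 ∧ ∀ τ ∈ Icc s t, 0 < (α τ).2) :
    ∀ t, s ≤ t → (α t).1 ∈ Icc (0 : ℝ) 1 ∧ (α t).2 ∈ Icc (0 : ℝ) 1 := by
  set p : ℝ → ℝ := fun t => (α t).1 with hp
  set q : ℝ → ℝ := fun t => (α t).2 with hq
  set ρ : ℝ → ℝ := fun t => (truncatedField a b c t (α t)).2 with hρ
  have hαc : Continuous α := continuous_iff_continuousAt.2 fun t => (hα t).continuousAt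
  have hqc : Continuous q := continuous_snd.comp hαc
  have hρc : Continuous ρ := continuous_snd.comp
    ((continuous_truncatedField a b c).comp (continuous_id.prodMk hαc))
  have hqd : ∀ t, HasDerivAt q (ρ t) t := fun t =>
    (hasFDerivAt_snd (𝕜 := ℝ) (p := α t)).comp_hasDerivAt t (hα t)
  -- the trajectory is confined as long as the slope is nonnegative and nonincreasing
  have hconf : ∀ t, s ≤ t → (∀ τ ∈ Icc s t, 0 ≤ q τ ∧ (τ < t → ρ τ ≤ 0)) →
      p t ∈ Icc (0 : ℝ) 1 ∧ q t ∈ Icc (0 : ℝ) 1 := by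
    intro t hst h
    have hq1 : ∀ τ ∈ Icc s t, q τ ∈ Icc (0 : ℝ) 1 := by
      intro τ hτ
      refine ⟨(h τ hτ).1, ?_⟩
      have hle : q τ ≤ q s := by
        rcases hτ.1.eq_or_lt with e | hlt
        · rw [e]
        obtain ⟨ξ, hξ, e⟩ := exists_sub_eq_deriv_mul hlt (fun x _ => hqd x)
        have := mul_nonpos_of_nonpos_of_nonneg
          ((h ξ ⟨hξ.1.le, hξ.2.le.trans hτ.2⟩).2 (hξ.2.trans_le hτ.2)) (sub_nonneg.2 hτ.1)
        linarith
      have : q s ≤ 1 := hdiag.ge.trans hs.2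
      linarith
    exact ⟨fst_mem_Icc_of_snd_mem_Icc hα hst hs hq1, hq1 t (right_mem_Icc.2 hst)⟩
  have hρ_eq : ∀ t, p t ∈ Icc (0 : ℝ) 1 → q t ∈ Icc (0 : ℝ) 1 → ρ t = slopeRate a b c p q t :=
    fun t h1 h2 => (hqd t).unique (hasDerivAt_components hα h1 h2).2
  suffices hgood : ∀ t, s ≤ t → 0 < q t ∧ ρ t < 0 from fun t hst =>
    hconf t hst fun τ hτ => ⟨(hgood τ hτ.1).1.le, fun _ => (hgood τ hτ.1).2.le⟩
  by_contra! hbad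
  set B : Set ℝ := {t | s ≤ t ∧ (q t ≤ 0 ∨ 0 ≤ ρ t)} with hB
  have hBne : B.Nonempty := by
    obtain ⟨t, hst, ht⟩ := hbad
    refine ⟨t, hst, ?_⟩
    by_cases h : 0 < q t
    · exact Or.inr (ht h)
    · exact Or.inl (not_lt.1 h)
  have hBbdd : BddBelow B := ⟨s, fun t ht => ht.1⟩
  have hBclosed : IsClosed B := (isClosed_le continuous_const continuous_id).inter
    ((isClosed_le hqc continuous_const).union (isClosed_le continuous_const hρc))
  obtain ⟨hsT, hT⟩ : sInf B ∈ B := hBclosed.csInf_mem hBne hBbdd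
  set T := sInf B with hTdef
  have hbefore : ∀ τ, s ≤ τ → τ < T → 0 < q τ ∧ ρ τ < 0 := by
    intro τ h1 h2
    by_contra! h
    refine absurd (csInf_le hBbdd (show τ ∈ B from ⟨h1, ?_⟩)) (not_le.2 h2)
    by_cases h' : 0 < q τ
    · exact Or.inr (h h')
    · exact Or.inl (not_lt.1 h')
  have hleft : s < T → ∀ᶠ τ in 𝓝[<] T, 0 < q τ ∧ ρ τ < 0 := fun h => by
    filter_upwards [Ioo_mem_nhdsLT h] with τ hτ using hbefore τ hτ.1.le hτ.2
  have hq_left : Tendsto q (𝓝[<] T) (𝓝 (q T)) := hqc.continuousAt.continuousWithinAt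
  have hρ_left : Tendsto ρ (𝓝[<] T) (𝓝 (ρ T)) := hρc.continuousAt.continuousWithinAt
  have hqT : 0 ≤ q T := by
    rcases hsT.eq_or_lt with e | h
    · rw [← e]; exact hs.1.trans hdiag.le
    · exact ge_of_tendsto hq_left ((hleft h).mono fun τ hτ => hτ.1.le)
  have hTconf := hconf T hsT fun τ hτ => by
    rcases hτ.2.eq_or_lt with e | h
    · exact ⟨e ▸ hqT, fun h => absurd e h.ne⟩
    · exact ⟨(hbefore τ hτ.1 h).1.le, fun _ => (hbefore τ hτ.1 h).2.le⟩
  rcases hqT.eq_or_lt with hq0 | hqpos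
  · -- the slope vanishes at `T`
    rcases lt_trichotomy (ρ T) 0 with hr | hr | hr
    · obtain ⟨δ, hδ, hlt, -⟩ := (hqd T).exists_forall_Ioo_gt hr
      obtain ⟨ε, hε, hneg⟩ := Metric.eventually_nhds_iff.1
        (hρc.continuousAt.eventually (gt_mem_nhds hr))
      have hm : 0 < min δ ε := lt_min hδ hε
      refine hdown ⟨T + min δ ε / 2, by linarith, ?_, fun τ hτ => ?_⟩
      · have := hlt (T + min δ ε / 2) ⟨by linarith, by linarith [min_le_left δ ε]⟩
        linarith
      · rcases lt_or_ge τ T with h | h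
        · exact (hbefore τ hτ.1 h).2
        · exact hneg (by
            rw [Real.dist_eq, abs_lt]
            constructor <;> linarith [hτ.2, min_le_right δ ε])
    -- Linear uniqueness carries q = r = 0 back to s; on the diagonal then p s = 0, so r s = -c
    -- e^{-s} ≠ 0.
    · have hmem : ∀ τ ∈ Icc s T, p τ ∈ Icc (0 : ℝ) 1 ∧ q τ ∈ Icc (0 : ℝ) 1 := by
        intro τ hτ
        rcases hτ.2.eq_or_lt with e | h
        · rw [e]; exact hTconf
        · exact hconf τ hτ.1 fun x hx => ⟨(hbefore x hx.1 (hx.2.trans_lt h)).1.le,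
            fun _ => (hbefore x hx.1 (hx.2.trans_lt h)).2.le⟩
      have hz := planar_linear_eq_zero (z := q) (w := slopeRate a b c p q) (α := fun _ => 0)
        (β := fun _ => 1) (γ := fun _ => a + b) (δ := slopeDamping a c q) (l := s) (m := T)
        (right_mem_Icc.2 hsT) continuousOn_const continuousOn_const continuousOn_const
        (by unfold slopeDamping; fun_prop)
        (fun τ hτ => by
          simpa using (hasDerivAt_components hα (hmem τ hτ).1 (hmem τ hτ).2).2)
        (fun τ hτ => by
          obtain ⟨h1, h2⟩ := hasDerivAt_components hα (hmem τ hτ).1 (hmem τ hτ).2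
          exact hasDerivAt_slopeRate h1 h2)
        hq0.symm ((hρ_eq T hTconf.1 hTconf.2).symm.trans hr) s (left_mem_Icc.2 hsT)
      have hps : p s = 0 := hdiag.trans hz.1
      have := hz.2
      simp only [slopeRate, hz.1, hps] at this
      have hpos := mul_pos hc (Real.exp_pos (-s))
      linarith
    · rcases hsT.eq_or_lt with e | h
      · have hq0' : q s = 0 := by rw [e]; exact hq0.symm
        have hps : p s = 0 := hdiag.trans hq0'
        rw [hρ_eq T hTconf.1 hTconf.2, ← e] at hr
        simp only [slopeRate, hq0', hps] at hr
        have hpos := mul_pos hc (Real.exp_pos (-s))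
        linarith
      · exact absurd (le_of_tendsto hρ_left ((hleft h).mono fun τ hτ => hτ.2.le)) (not_le.2 hr)
  · have hρ0 : 0 ≤ ρ T := hT.resolve_left (not_le.2 hqpos)
    have hpos_before : ∀ τ ∈ Icc s T, 0 < q τ := fun τ hτ => by
      rcases hτ.2.eq_or_lt with e | h
      · rw [e]; exact hqpos
      · exact (hbefore τ hτ.1 h).1
    rcases hρ0.eq_or_lt with hr | hr
    · obtain ⟨h1, h2⟩ := hasDerivAt_components hα hTconf.1 hTconf.2
      have hd := hasDerivAt_slopeRate h1 h2
      have hr' : slopeRate a b c p q T = 0 := (hρ_eq T hTconf.1 hTconf.2).symm.trans hr.symm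
      -- Near T the orbit lies inside (-1, 2)², where truncation is inactive, so ρ inherits the
      -- derivative (a+b) q > 0 and an upward exit follows.
      have hd' : HasDerivAt ρ ((a + b) * q T) T := by
        have hp1 : p T < 2 := by linarith [hTconf.1.2]
        have hp0 : -1 < p T := by linarith [hTconf.1.1]
        have hq1 : q T < 2 := by linarith [hTconf.2.2]
        have hq0 : -1 < q T := by linarith
        have hpc : Continuous p := continuous_fst.comp hαc
        have hev : ρ =ᶠ[𝓝 T] slopeRate a b c p q := by
          filter_upwards [hpc.continuousAt.eventually (gt_mem_nhds hp1),
            hpc.continuousAt.eventually (lt_mem_nhds hp0),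
            hqc.continuousAt.eventually (gt_mem_nhds hq1),
            hqc.continuousAt.eventually (lt_mem_nhds hq0)] with x x1 x2 x3 x4
          change a * truncate (q x) + b * truncate (p x)
            - c * Real.exp (-x) * (truncate (q x) - 1) ^ 2 = _
          rw [truncate_of_mem x2.le x1.le, truncate_of_mem x4.le x3.le, slopeRate]
        rw [hr', mul_zero, add_zero] at hd
        exact hd.congr_of_eventuallyEq hev
      obtain ⟨δ, hδ, hlt, -⟩ := hd'.exists_forall_Ioo_lt (mul_pos hab hqpos)
      obtain ⟨ε, hε, hpos⟩ := Metric.eventually_nhds_iff.1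
        (hqc.continuousAt.eventually (lt_mem_nhds hqpos))
      have hm : 0 < min δ ε := lt_min hδ hε
      refine hup ⟨T + min δ ε / 2, by linarith, ?_, fun τ hτ => ?_⟩
      · have := hlt (T + min δ ε / 2) ⟨by linarith, by linarith [min_le_left δ ε]⟩
        linarith
      · rcases le_or_gt τ T with h | h
        · exact hpos_before τ ⟨hτ.1, h⟩
        · exact hpos (by
            rw [Real.dist_eq, abs_lt]
            constructor <;> linarith [hτ.2, min_le_right δ ε])
    · exact hup ⟨T, hsT, hr, hpos_before⟩

end Shooting

/-! ### Existence of a confined orbit -/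

section Existence

variable {a b c : ℝ}

/-- Trajectories of a locally uniform field depend continuously on the initial value and time. -/
lemma IsLocallyUniformField.continuous_uncurry {E X : Type*} [NormedAddCommGroup E]
    [NormedSpace ℝ E] [TopologicalSpace X] {f : ℝ → E → E} (hf : IsLocallyUniformField f)
    {Y : X → ℝ → E} (hY : ∀ x t, HasDerivAt (Y x) (f t (Y x t)) t) {s : ℝ}
    (hs : Continuous fun x => Y x s) : Continuous fun z : X × ℝ => Y z.1 z.2 := by
  rw [continuous_iff_continuousAt]
  rintro ⟨x, t⟩
  set T := max |s| (|t| + 1) with hT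
  obtain ⟨C, hC, hle⟩ := hf.dist_le T
  have hsT : s ∈ Icc (-T) T := abs_le.1 (le_max_left _ _)
  have hYx : ContinuousAt (Y x) t := (hY x t).continuousAt
  rw [ContinuousAt, tendsto_iff_dist_tendsto_zero]
  have hlim : Tendsto (fun z : X × ℝ => C * dist (Y z.1 s) (Y x s) + dist (Y x z.2) (Y x t))
      (𝓝 (x, t)) (𝓝 (C * dist (Y x s) (Y x s) + dist (Y x t) (Y x t))) := by
    refine Tendsto.add (Tendsto.const_mul C (Tendsto.dist ?_ tendsto_const_nhds))
      (Tendsto.dist ?_ tendsto_const_nhds)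
    · exact (hs.tendsto x).comp (continuous_fst.tendsto (x, t))
    · exact hYx.tendsto.comp (continuous_snd.tendsto (x, t))
  rw [dist_self, dist_self, mul_zero, add_zero] at hlim
  refine squeeze_zero' (Eventually.of_forall fun _ => dist_nonneg) ?_ hlim
  have hnear : ∀ᶠ z : X × ℝ in 𝓝 (x, t), |z.2| < |t| + 1 :=
    ((continuous_abs.comp continuous_snd).tendsto (x, t)).eventually
      (gt_mem_nhds (lt_add_one |t|))
  filter_upwards [hnear] with z hz
  have hzT : z.2 ∈ Icc (-T) T := abs_le.1 (hz.le.trans (le_max_right _ _))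
  have h1 := hle (Y z.1) (Y x) (hY z.1) (hY x) s hsT z.2 hzT
  have h2 := dist_triangle (Y z.1 z.2) (Y x z.2) (Y x t)
  linarith

lemma exists_trajectory_right (hab : 0 < a + b) (hc : 0 < c) (s : ℝ) :
    ∃ α : ℝ → ℝ × ℝ, (∀ t, HasDerivAt α (truncatedField a b c t (α t)) t) ∧
      ∀ t, s ≤ t → (α t).1 ∈ Icc (0 : ℝ) 1 ∧ (α t).2 ∈ Icc (0 : ℝ) 1 := by
  have hf := isLocallyUniformField_truncatedField (a := a) (b := b) hc
  choose Y hYs hY using fun σ : ℝ => hf.exists_hasDerivAt s (σ, σ)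
  have hYc : Continuous fun z : ℝ × ℝ => Y z.1 z.2 :=
    hf.continuous_uncurry hY (s := s) (by simp only [hYs]; fun_prop)
  let ρ : ℝ → ℝ → ℝ := fun σ t => (truncatedField a b c t (Y σ t)).2
  have hρc : Continuous fun z : ℝ × ℝ => ρ z.1 z.2 :=
    continuous_snd.comp ((continuous_truncatedField a b c).comp (continuous_snd.prodMk hYc))
  have hqc : Continuous fun z : ℝ × ℝ => (Y z.1 z.2).2 := continuous_snd.comp hYc
  -- The sign conditions over all of [s, t] make D and U disjoint; compactness of [s, t] makes them
  -- open.
  let D : Set ℝ := {σ | ∃ t, s ≤ t ∧ (Y σ t).2 < 0 ∧ ∀ τ ∈ Icc s t, ρ σ τ < 0}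
  let U : Set ℝ := {σ | ∃ t, s ≤ t ∧ 0 < ρ σ t ∧ ∀ τ ∈ Icc s t, 0 < (Y σ τ).2}
  have hD : IsOpen D := by
    rw [isOpen_iff_eventually]
    rintro σ ⟨t, hst, h1, h2⟩
    have e1 : ∀ᶠ σ' in 𝓝 σ, (Y σ' t).2 < 0 :=
      (hqc.comp (continuous_id.prodMk continuous_const)).continuousAt.eventually (gt_mem_nhds h1)
    have e2 : ∀ᶠ σ' in 𝓝 σ, ∀ τ ∈ Icc s t, ρ σ' τ < 0 :=
      isCompact_Icc.eventually_forall_of_forall_eventually fun τ hτ =>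
        (hρc.tendsto (σ, τ)).eventually (gt_mem_nhds (h2 τ hτ))
    filter_upwards [e1, e2] with σ' h1 h2 using ⟨t, hst, h1, h2⟩
  have hU : IsOpen U := by
    rw [isOpen_iff_eventually]
    rintro σ ⟨t, hst, h1, h2⟩
    have e1 : ∀ᶠ σ' in 𝓝 σ, 0 < ρ σ' t :=
      (hρc.comp (continuous_id.prodMk continuous_const)).continuousAt.eventually (lt_mem_nhds h1)
    have e2 : ∀ᶠ σ' in 𝓝 σ, ∀ τ ∈ Icc s t, 0 < (Y σ' τ).2 :=
      isCompact_Icc.eventually_forall_of_forall_eventually fun τ hτ =>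
        (hqc.tendsto (σ, τ)).eventually (lt_mem_nhds (h2 τ hτ))
    filter_upwards [e1, e2] with σ' h1 h2 using ⟨t, hst, h1, h2⟩
  have hdisj : ∀ σ, σ ∈ D → σ ∈ U → False := by
    rintro σ ⟨t, hst, h1, h2⟩ ⟨t', hst', h1', h2'⟩
    rcases le_total t t' with h | h
    · exact lt_asymm h1 (h2' t ⟨hst, h⟩)
    · exact lt_asymm h1' (h2 t' ⟨hst', h⟩)
  have htr0 : truncate 0 = 0 := truncate_of_mem (by norm_num) (by norm_num)
  have htr1 : truncate 1 = 1 := truncate_of_mem (by norm_num) (by norm_num)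
  have h0 : (0 : ℝ) ∈ D := by
    have hr : (truncatedField a b c s (Y 0 s)).2 < 0 := by
      rw [hYs]
      simp only [truncatedField, htr0]
      have := mul_pos hc (Real.exp_pos (-s))
      linarith
    have hd : HasDerivAt (fun t => (Y 0 t).2) (truncatedField a b c s (Y 0 s)).2 s :=
      (hasFDerivAt_snd (𝕜 := ℝ) (p := Y 0 s)).comp_hasDerivAt s (hY 0 s)
    obtain ⟨δ, hδ, hlt, -⟩ := hd.exists_forall_Ioo_gt hr
    obtain ⟨ε, hε, hneg⟩ := Metric.eventually_nhds_iff.1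
      ((hρc.comp (continuous_const.prodMk continuous_id)).continuousAt.eventually
        (gt_mem_nhds hr))
    have hm : 0 < min δ ε := lt_min hδ hε
    refine ⟨s + min δ ε / 2, by linarith, ?_, fun τ hτ => ?_⟩
    · have := hlt (s + min δ ε / 2) ⟨by linarith, by linarith [min_le_left δ ε]⟩
      rwa [hYs] at this
    · exact hneg (by
        rw [Real.dist_eq, abs_lt]
        constructor <;> linarith [hτ.1, hτ.2, min_le_right δ ε])
  have h1 : (1 : ℝ) ∈ U := by
    refine ⟨s, le_rfl, ?_, fun τ hτ => ?_⟩
    · simp only [ρ, hYs, truncatedField, htr1]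
      linarith
    · rw [le_antisymm hτ.2 hτ.1, hYs]
      exact one_pos
  have hex : ∃ σ ∈ Icc (0 : ℝ) 1, σ ∉ D ∧ σ ∉ U := by
    by_contra! hcover
    obtain ⟨σ, -, hσD, hσU⟩ := isPreconnected_Icc (a := (0 : ℝ)) (b := 1) D U hD hU
      (fun σ hσ => by
        by_cases h : σ ∈ D
        · exact Or.inl h
        · exact Or.inr (hcover σ hσ h))
      ⟨0, left_mem_Icc.2 zero_le_one, h0⟩ ⟨1, right_mem_Icc.2 zero_le_one, h1⟩
    exact hdisj σ hσD hσU
  obtain ⟨σ, hσ, hσD, hσU⟩ := hex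
  exact ⟨Y σ, hY σ, forall_mem_of_not_exit hab hc (hY σ) (by rw [hYs]; exact hσ)
    (by rw [hYs]) hσD hσU⟩

lemma exists_isConfinedOrbit (hab : 0 < a + b) (hc : 0 < c) :
    ∃ p q : ℝ → ℝ, IsConfinedOrbit a b c p q := by
  have hf := isLocallyUniformField_truncatedField (a := a) (b := b) hc
  choose α hα hmem using fun n : ℕ => exists_trajectory_right hab hc (-(n : ℝ))
  let Q : Set (ℝ × ℝ) := Icc (0 : ℝ) 1 ×ˢ Icc (0 : ℝ) 1
  have hQ : IsCompact Q := isCompact_Icc.prod isCompact_Icc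
  -- The n-th trajectory is confined from time -n on, hence already at time 0.
  obtain ⟨y, -, φ, hφ, hlim⟩ := hQ.tendsto_subseq (x := fun n => α n 0)
    fun n => hmem n 0 (by simp)
  obtain ⟨β, hβ0, hβ⟩ := hf.exists_hasDerivAt 0 y
  have hβmem : ∀ t, β t ∈ Q := by
    intro t
    obtain ⟨C, -, hC⟩ := hf.dist_le |t|
    have hconv : Tendsto (fun n => α (φ n) t) atTop (𝓝 (β t)) := by
      rw [tendsto_iff_dist_tendsto_zero] at hlim ⊢
      refine squeeze_zero (fun _ => dist_nonneg) (fun n => ?_)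
        (by simpa using hlim.const_mul C)
      have := hC (α (φ n)) β (hα _) hβ 0 (by simp) t (abs_le.1 le_rfl)
      rwa [hβ0] at this
    refine hQ.isClosed.mem_of_tendsto hconv ?_
    obtain ⟨N, hN⟩ := exists_nat_gt (-t)
    filter_upwards [eventually_ge_atTop N] with n hn
    refine hmem (φ n) t ?_
    have : (N : ℝ) ≤ φ n := by exact_mod_cast hn.trans (hφ.id_le n)
    linarith
  exact ⟨fun t => (β t).1, fun t => (β t).2,
    { hasDerivAt_fst := fun t => (hasDerivAt_components hβ (hβmem t).1 (hβmem t).2).1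
      hasDerivAt_snd := fun t => (hasDerivAt_components hβ (hβmem t).1 (hβmem t).2).2
      fst_nonneg := fun t => (hβmem t).1.1
      fst_le_one := fun t => (hβmem t).1.2 }⟩

end Existence

/-! ### Passing between solutions and orbits -/

/-- A solution of the equation with `0 ≤ u x ≤ x` gives a confined orbit. -/
lemma IsGlobalSolution.isConfinedOrbit {a b c : ℝ} {u : ℝ → ℝ} (hu : IsGlobalSolution a b c u)
    (hbd : ∀ x : ℝ, 0 < x → 0 ≤ u x ∧ u x ≤ x) :
    IsConfinedOrbit a b c (fun t => u (Real.exp t) * Real.exp (-t))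
      (fun t => deriv u (Real.exp t)) := by
  have hd1 : ∀ x : ℝ, 0 < x → HasDerivAt u (deriv u x) x := fun x hx =>
    ((hu.contDiffOn.differentiableOn (by norm_num)).differentiableAt
      (Ioi_mem_nhds hx)).hasDerivAt
  have hd2 : ∀ x : ℝ, 0 < x → HasDerivAt (deriv u) (deriv (deriv u) x) x := fun x hx =>
    (((contDiffOn_succ_iff_deriv_of_isOpen (n := 1) isOpen_Ioi).1
      hu.contDiffOn).2.2.differentiableOn (by norm_num) |>.differentiableAt
      (Ioi_mem_nhds hx)).hasDerivAt
  have hexp : ∀ t : ℝ, Real.exp t * Real.exp (-t) = 1 := fun t => by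
    rw [← Real.exp_add]; simp
  constructor
  · intro t
    refine (((hd1 _ (Real.exp_pos t)).comp t (Real.hasDerivAt_exp t)).mul
      (hasDerivAt_exp_neg t)).congr_deriv ?_
    simp only [Function.comp_apply]
    linear_combination (deriv u (Real.exp t)) * hexp t
  · intro t
    refine ((hd2 _ (Real.exp_pos t)).comp t (Real.hasDerivAt_exp t)).congr_deriv ?_
    have h := hu.ode _ (Real.exp_pos t)
    simp only [slopeRate]
    linear_combination (Real.exp (-t)) * h
      + (a * deriv u (Real.exp t) - deriv (deriv u) (Real.exp t) * Real.exp t) * hexp t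
  · exact fun t => mul_nonneg (hbd _ (Real.exp_pos t)).1 (Real.exp_pos (-t)).le
  · intro t
    rw [← hexp t]
    exact mul_le_mul_of_nonneg_right (hbd _ (Real.exp_pos t)).2 (Real.exp_pos (-t)).le

namespace IsConfinedOrbit

variable {a b c : ℝ} {p q : ℝ → ℝ}

lemma exp_neg_log {x : ℝ} (hx : 0 < x) : Real.exp (-Real.log x) = x⁻¹ := by
  rw [Real.exp_neg, Real.exp_log hx]

lemma hasDerivAt_solution (h : IsConfinedOrbit a b c p q) {x : ℝ} (hx : 0 < x) :
    HasDerivAt (fun x => x * p (Real.log x)) (q (Real.log x)) x := by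
  refine ((hasDerivAt_id x).mul ((h.hasDerivAt_fst _).comp x
    (Real.hasDerivAt_log hx.ne'))).congr_deriv ?_
  simp only [Function.comp_apply, id]
  field_simp
  ring

lemma hasDerivAt_slope (h : IsConfinedOrbit a b c p q) {x : ℝ} (hx : 0 < x) :
    HasDerivAt (fun x => q (Real.log x)) (slopeRate a b c p q (Real.log x) / x) x :=
  ((h.hasDerivAt_snd _).comp x (Real.hasDerivAt_log hx.ne')).congr_deriv (by ring)

lemma hasDerivAt_second (h : IsConfinedOrbit a b c p q) {x : ℝ} (hx : 0 < x) :
    HasDerivAt (fun x => slopeRate a b c p q (Real.log x) / x)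
      (thirdRate a b c p q (Real.log x) / x ^ 2) x := by
  refine (((h.hasDerivAt_rate _).comp x (Real.hasDerivAt_log hx.ne')).div (hasDerivAt_id x)
    hx.ne').congr_deriv ?_
  simp only [Function.comp_apply, id, thirdRate]
  field_simp
  ring

lemma deriv_solution (h : IsConfinedOrbit a b c p q) {x : ℝ} (hx : 0 < x) :
    deriv (fun x => x * p (Real.log x)) x = q (Real.log x) :=
  (h.hasDerivAt_solution hx).deriv

lemma deriv_deriv_solution (h : IsConfinedOrbit a b c p q) {x : ℝ} (hx : 0 < x) :
    deriv (deriv fun x => x * p (Real.log x)) x = slopeRate a b c p q (Real.log x) / x := by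
  have hev : deriv (fun x => x * p (Real.log x)) =ᶠ[𝓝 x] fun x => q (Real.log x) := by
    filter_upwards [Ioi_mem_nhds hx] with y hy using h.deriv_solution hy
  rw [hev.deriv_eq, (h.hasDerivAt_slope hx).deriv]

lemma deriv_deriv_deriv_solution (h : IsConfinedOrbit a b c p q) {x : ℝ} (hx : 0 < x) :
    deriv (deriv (deriv fun x => x * p (Real.log x))) x
      = thirdRate a b c p q (Real.log x) / x ^ 2 := by
  have hev : deriv (deriv fun x => x * p (Real.log x))
      =ᶠ[𝓝 x] fun x => slopeRate a b c p q (Real.log x) / x := by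
    filter_upwards [Ioi_mem_nhds hx] with y hy using h.deriv_deriv_solution hy
  rw [hev.deriv_eq, (h.hasDerivAt_second hx).deriv]

lemma solution_mem (h : IsConfinedOrbit a b c p q) {x : ℝ} (hx : 0 < x) :
    0 ≤ x * p (Real.log x) ∧ x * p (Real.log x) ≤ x :=
  ⟨mul_nonneg hx.le (h.fst_nonneg _), mul_le_of_le_one_right hx.le (h.fst_le_one _)⟩

lemma isGlobalSolution (h : IsConfinedOrbit a b c p q) :
    IsGlobalSolution a b c fun x => x * p (Real.log x) where
  continuousOn := by
    intro x hx
    rcases (mem_Ici.1 hx).eq_or_lt with rfl | hx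
    · rw [ContinuousWithinAt, zero_mul]
      refine squeeze_zero' (g := fun x => x) ?_ ?_ (tendsto_id.mono_left nhdsWithin_le_nhds) <;>
        filter_upwards [self_mem_nhdsWithin] with y hy
      · exact mul_nonneg hy (h.fst_nonneg _)
      · exact mul_le_of_le_one_right hy (h.fst_le_one _)
    · exact (h.hasDerivAt_solution hx).continuousAt.continuousWithinAt
  contDiffOn := by
    have h1 : ContDiffOn ℝ 1 (fun x => q (Real.log x)) (Ioi 0) := by
      refine (contDiffOn_succ_iff_deriv_of_isOpen (n := 0) isOpen_Ioi).2
        ⟨fun x hx => (h.hasDerivAt_slope hx).differentiableAt.differentiableWithinAt,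
          by simp, contDiffOn_zero.2 ?_⟩
      refine ContinuousOn.congr (f := fun x => slopeRate a b c p q (Real.log x) / x)
        (fun x hx => (h.hasDerivAt_second hx).continuousAt.continuousWithinAt)
        fun x hx => (h.hasDerivAt_slope hx).deriv
    exact (contDiffOn_succ_iff_deriv_of_isOpen (n := 1) isOpen_Ioi).2
      ⟨fun x hx => (h.hasDerivAt_solution hx).differentiableAt.differentiableWithinAt,
        by simp, h1.congr fun x hx => h.deriv_solution hx⟩
  ode x hx := by
    rw [h.deriv_deriv_solution hx, h.deriv_solution hx, slopeRate, exp_neg_log hx]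
    field_simp
  -- The factor x removes the dependence on the default value of `Real.log 0`.
  initial := by simp

end IsConfinedOrbit

theorem proposition4p1 (a b c : ℝ) (hab : 0 < a + b) (hc : 0 < c) :
    ∃ u : ℝ → ℝ,
      (IsGlobalSolution a b c u ∧ ∀ x : ℝ, 0 < x → 0 ≤ u x ∧ u x ≤ x) ∧
      (∀ v : ℝ → ℝ,
        (IsGlobalSolution a b c v ∧ ∀ x : ℝ, 0 < x → 0 ≤ v x ∧ v x ≤ x) →
          Set.EqOn v u (Set.Ici 0)) ∧
      ∀ x : ℝ, 0 < x →
        0 < u x ∧ 0 < deriv u x ∧ deriv (deriv u) x < 0 ∧ 0 < deriv (deriv (deriv u)) x := by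
  obtain ⟨p, q, h⟩ := exists_isConfinedOrbit hab hc
  refine ⟨fun x => x * p (Real.log x), ⟨h.isGlobalSolution, fun x hx => h.solution_mem hx⟩,
    fun v ⟨hv, hbd⟩ x hx => ?_, fun x hx => ⟨mul_pos hx (h.fst_pos hab hc _), ?_, ?_, ?_⟩⟩
  · rcases (mem_Ici.1 hx).eq_or_lt with rfl | hx
    · simp [hv.initial]
    · have h' := hv.isConfinedOrbit hbd
      have e := le_antisymm (h'.fst_le_fst h hab hc (Real.log x))
        (h.fst_le_fst h' hab hc (Real.log x))
      simp only [Real.exp_log hx, IsConfinedOrbit.exp_neg_log hx] at e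
      change v x = x * p (Real.log x)
      rw [← e]
      field_simp
  · rw [h.deriv_solution hx]
    exact h.snd_pos hab hc _
  · rw [h.deriv_deriv_solution hx]
    exact div_neg_of_neg_of_pos (h.rate_neg hab hc _) hx
  · rw [h.deriv_deriv_deriv_solution hx]
    exact div_pos (h.third_pos hab hc _) (pow_pos hx 2)
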